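/- Let $\mu_1,\mu_2$ be finite measures on $[0,1]$, let $H_\ell=L^2_{\mu_\ell}[0,1]$ (real scalars) and $H=H_1\otimes H_2=L^2(\mu_1\otimes\mu_2)$, with $(f\otimes g)(s,t)=f(s)g(t)$. Let $\mathcal S_1$ and $\mathcal S_2$ denote the trace-class and Hilbert--Schmidt operators with norms $\|\cdot\|_1$, $\|\cdot\|_2$; for operators, $A\otimes B$ is the operator with $(A\otimes B)(x\otimes y)=Ax\otimes By$. Let $I=[a,b]$ with $0<a\le b\le 1$, give $\mathcal C(I,\mathcal S_p(H,H))$ the maximum norm, and let $C\in\mathcal S_1(H,H)$ (for instance the covariance operator of a square-integrable random element of $H$). * Partial traces: $\mathrm{Tr}_1[A\otimes B]=\mathrm{Tr}[A]B$ and $\mathrm{Tr}_2[A\otimes B]=\mathrm{Tr}[B]A$, extended to bounded linear maps on $\mathcal S_1(H,H)$. If $\mathrm{Tr}[L]\ne0$, put $L^{\rm tr}=\frac{\mathrm{Tr}_2[L]}{\mathrm{Tr}[L]}\otimes\mathrm{Tr}_1[L]$. * Partial products: for $L\in\mathcal S_2(H,H)$, $A\in\mathcal S_2(H_1,H_1)$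 and $B\in\mathcal S_2(H_2,H_2)$, the operators $P_1(L,A)\in\mathcal S_2(H_2,H_2)$ and $P_2(L,B)\in\mathcal S_2(H_1,H_1)$ are determined by $\langle P_1(L,A),B'\rangle=\langle L,A\otimes B'\rangle$ for all $B'$ and $\langle P_2(L,B),A'\rangle=\langle L,A'\otimes B\rangle$ for all $A'$. For fixed $\Delta\in\mathcal S_2(H_2,H_2)$ with $P_2(L,\Delta)\neq0$, put $L^{\rm prod}=P_2(L,\Delta)\otimes P_1(L,P_2(L,\Delta))/\|P_2(L,\Delta)\|_2^2$. * Optimal approximations: let $\Pi[L]:\mathcal S_2(H_1,H_1)\to\mathcal S_2(H_2,H_2)$, $\Pi[L]A=P_1(L,A)$, be the restacked operator (so $\Pi[A\otimes B]=\langle A,\cdot\rangle B$). Let $\gamma_1$ be its largest singular value, with normalized singular vectors $e_1,f_1$ ($\Pi[L]e_1=\gamma_1f_1$, $\Pi[L]^*f_1=\gamma_1e_1$), and put $L^{\rm opt}=\gamma_1\,e_1\otimes f_1$. An optimal separable approximation of $L$ is a minimizer of $\|L-A\otimes B\|_2^2$ among the operators $A\otimes B$ with $A\in\mathcal S_2(H_1,H_1)$,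 $B\in\mathcal S_2(H_2,H_2)$. Apply all these maps pointwise in $\lambda\in I$. Then: (i) If $\mathrm{Tr}[C]\neq 0$, the map $L\mapsto L-L^{\rm tr}$ is well defined, with values in $\mathcal C(I,\mathcal S_1(H,H))$, in a neighbourhood of $\lambda\mapsto\lambda C$ in $\mathcal C(I,\mathcal S_1(H,H))$, and it is Fréchet differentiable at $\lambda\mapsto\lambda C$ with derivative given pointwise by $$h\mapsto h-\Big(\frac{\mathrm{Tr}_2[h]}{\mathrm{Tr}[C]}-\frac{\mathrm{Tr}[h]\,\mathrm{Tr}_2[C]}{\mathrm{Tr}[C]^2}\Big)\otimes\mathrm{Tr}_1[C]-\frac{\mathrm{Tr}_2[C]}{\mathrm{Tr}[C]}\otimes\mathrm{Tr}_1[h].$$ (ii) If $p:=P_2(C,\Delta)\ne0$, the map $L\mapsto L-L^{\rm prod}$ is well defined, with values in $\mathcal C(I,\mathcal S_2(H,H))$, in a neighbourhood of $\lambda\mapsto\lambda C$ in $\mathcal C(I,\mathcal S_2(H,H))$, and it is Fréchet differentiable at $\lambda\mapsto\lambda C$; with $q=P_1(C,p)$ and $\dot p=P_2(h,\Delta)$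 the derivative is given pointwise by $$h\mapsto h-\frac{\dot p\otimes q+p\otimes\big(P_1(C,\dot p)+P_1(h,p)\big)}{\|p\|_2^2}+\frac{2\langle\dot p,p\rangle}{\|p\|_2^4}\,p\otimes q.$$ (iii) If $C\neq0$ and the optimal separable approximation of $C$ is unique (equivalently, the two largest singular values of $\Pi[C]$ satisfy $\gamma_1>\gamma_2$), then for all $L$ in a neighbourhood of $\lambda\mapsto\lambda C$ in $\mathcal C(I,\mathcal S_2(H,H))$ the operator $L^{\rm opt}(\lambda)$ is, for every $\lambda\in I$, the unique optimal separable approximation of $L(\lambda)$ and is continuous in $\lambda$, and $L\mapsto L-L^{\rm opt}$ is Fréchet differentiable at $\lambda\mapsto\lambda C$. Let $A=\Pi[C]$, $K=\Pi[h]$; let $(e_i)$ and $(f_k)$ be any orthonormal bases of eigenvectors, $A^*Ae_i=\alpha_ie_i$ and $AA^*f_k=\beta_kf_k$, such that for one index each, denoted $1$, $e_1$ and $f_1$ are singular vectors of $A$ for $\gamma_1$. Then the derivative is given pointwise by $$h\mapsto h-\big(\langle Ke_1,f_1\rangle\,e_1\otimes f_1+\gamma_1\,u\otimes f_1+\gamma_1\,e_1\otimes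 v\big),$$ $$u=\sum_{i\ne1}\frac{\langle (A^*K+K^*A)e_1,e_i\rangle}{\gamma_1^2-\alpha_i}\,e_i,\qquad v=\sum_{k\neq1}\frac{\langle (AK^*+KA^*)f_1,f_k\rangle}{\gamma_1^2-\beta_k}\,f_k.$$ -/

import Mathlib

set_option linter.unusedSectionVars false
set_option linter.unusedVariables false

open MeasureTheory Filter Topology
open scoped InnerProductSpace ENNReal

noncomputable section

namespace SepApprox

section HilbertSchmidt

variable (E F : Type*) [NormedAddCommGroup E] [InnerProductSpace ℝ E] [CompleteSpace E]
  [NormedAddCommGroup F] [InnerProductSpace ℝ F]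

/-- The index set of a fixed orthonormal (Hilbert) basis of `E`. -/
def basisIndex : Set E := (exists_hilbertBasis ℝ E).choose

/-- A fixed orthonormal (Hilbert) basis of `E`. -/
def stdBasis : HilbertBasis (basisIndex E) ℝ E := (exists_hilbertBasis ℝ E).choose_spec.choose

theorem memlp_two_iff {ι G : Type*} [NormedAddCommGroup G] (f : ι → G) :
    Memℓp f 2 ↔ Summable fun i => ‖f i‖ ^ 2 := by
  rw [memℓp_gen_iff (by simp)]
  simp

/-- The Hilbert-Schmidt operators: bounded operators `T` with `∑ ‖T eᵢ‖² < ∞`. -/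
def hilbertSchmidt : Submodule ℝ (E →L[ℝ] F) where
  carrier := {T | Summable fun i => ‖T (stdBasis E i)‖ ^ 2}
  add_mem' {S T} hS hT := by
    rw [Set.mem_ofPred_eq, ← memlp_two_iff] at hS hT ⊢
    exact hS.add hT
  zero_mem' := by simp
  smul_mem' c T hT := by
    rw [Set.mem_ofPred_eq, ← memlp_two_iff] at hT ⊢
    exact hT.const_smul c

/-- The space `S₂(E, F)` of Hilbert-Schmidt operators. -/
def HS : Type _ := ↥(hilbertSchmidt E F)

instance : AddCommGroup (HS E F) := inferInstanceAs (AddCommGroup ↥(hilbertSchmidt E F))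
instance : Module ℝ (HS E F) := inferInstanceAs (Module ℝ ↥(hilbertSchmidt E F))

namespace HS

variable {E F}

/-- The bounded operator underlying a Hilbert-Schmidt operator. -/
def toCLM : HS E F →ₗ[ℝ] (E →L[ℝ] F) := (hilbertSchmidt E F).subtype

theorem toCLM_injective : Function.Injective (toCLM (E := E) (F := F)) := Subtype.val_injective

theorem summable_sq (T : HS E F) : Summable fun i => ‖toCLM T (stdBasis E i)‖ ^ 2 := T.2

theorem clm_ext_basis {S T : E →L[ℝ] F} {ι : Type*} (b : HilbertBasis ι ℝ E)
    (h : ∀ i, S (b i) = T (b i)) : S = T := by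
  refine ContinuousLinearMap.ext_on (s := Set.range b) ?_ ?_
  · have := b.dense_span
    rw [Submodule.dense_iff_topologicalClosure_eq_top]
    exact this
  · rintro _ ⟨i, rfl⟩
    exact h i

variable (E F) in
/-- The family `(T eᵢ)ᵢ` as an element of `ℓ²`. -/
def toLp : HS E F →ₗ[ℝ] lp (fun _ : basisIndex E => F) 2 where
  toFun T := ⟨fun i => toCLM T (stdBasis E i), (memlp_two_iff _).2 T.2⟩
  map_add' S T := by ext i; simp; rfl
  map_smul' c T := by ext i; simp

@[simp] theorem toLp_apply (T : HS E F) (i : basisIndex E) :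
    (toLp E F T : ∀ _, F) i = toCLM T (stdBasis E i) := rfl

theorem toLp_injective : Function.Injective (toLp E F) := by
  intro S T h
  apply toCLM_injective
  refine clm_ext_basis (stdBasis E) fun i => ?_
  rw [← toLp_apply, ← toLp_apply, h]

/-- The Hilbert-Schmidt norm `‖T‖₂ = (∑ ‖T eᵢ‖²)^(1/2)`. -/
instance : NormedAddCommGroup (HS E F) :=
  NormedAddCommGroup.induced (HS E F) (lp (fun _ : basisIndex E => F) 2) (toLp E F) toLp_injective

/-- The Hilbert-Schmidt inner product `⟪S, T⟫₂ = ∑ ⟪S eᵢ, T eᵢ⟫`. -/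
instance : InnerProductSpace ℝ (HS E F) where
  toNormedSpace := NormedSpace.induced ℝ (HS E F) (lp (fun _ : basisIndex E => F) 2) (toLp E F)
  inner S T := ⟪toLp E F S, toLp E F T⟫_ℝ
  norm_sq_eq_re_inner T := norm_sq_eq_re_inner (𝕜 := ℝ) (toLp E F T)
  conj_inner_symm S T := inner_conj_symm (𝕜 := ℝ) (toLp E F S) (toLp E F T)
  add_left S S' T := by simp [inner_add_left]
  smul_left S T c := by simp [inner_smul_left]

theorem inner_def (S T : HS E F) : ⟪S, T⟫_ℝ = ⟪toLp E F S, toLp E F T⟫_ℝ := rfl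

theorem inner_eq_tsum (S T : HS E F) :
    ⟪S, T⟫_ℝ = ∑' i, ⟪toCLM S (stdBasis E i), toCLM T (stdBasis E i)⟫_ℝ :=
  lp.inner_eq_tsum _ _

theorem norm_sq_eq_tsum (T : HS E F) : ‖T‖ ^ 2 = ∑' i, ‖toCLM T (stdBasis E i)‖ ^ 2 := by
  rw [← real_inner_self_eq_norm_sq, inner_eq_tsum]
  simp


/-- Cauchy-Schwarz for series with nonnegative terms. -/
theorem cauchy_schwarz {ι : Type*} {f g : ι → ℝ} (hf0 : ∀ i, 0 ≤ f i) (hg0 : ∀ i, 0 ≤ g i)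
    (hf : Summable fun i => f i ^ 2) (hg : Summable fun i => g i ^ 2) :
    Summable (fun i => f i * g i) ∧
      ∑' i, f i * g i ≤ √(∑' i, f i ^ 2) * √(∑' i, g i ^ 2) := by
  have := Real.summable_and_inner_le_Lp_mul_Lq_tsum_of_nonneg
    (Real.HolderConjugate.two_two) hf0 hg0 (by simpa using hf) (by simpa using hg)
  simpa [Real.sqrt_eq_rpow] using this

theorem hasSum_sq_inner {ι : Type*} (b : HilbertBasis ι ℝ E) (x : E) :
    HasSum (fun i => ⟪b i, x⟫_ℝ ^ 2) (‖x‖ ^ 2) := by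
  have := b.hasSum_inner_mul_inner x x
  rw [real_inner_self_eq_norm_sq] at this
  simpa [real_inner_comm, sq] using this

theorem toLp_surjective [CompleteSpace F] : Function.Surjective (toLp E F) := by
  intro y
  have hy : Summable fun i => ‖(y : ∀ _, F) i‖ ^ 2 := (memlp_two_iff _).1 y.2
  have hx (x : E) : Summable fun i => |⟪stdBasis E i, x⟫_ℝ| ^ 2 := by
    simpa using (hasSum_sq_inner (stdBasis E) x).summable
  have key (x : E) := cauchy_schwarz (fun _ => abs_nonneg _) (fun _ => norm_nonneg _) (hx x) hy
  have hs (x : E) : Summable fun i => ‖⟪stdBasis E i, x⟫_ℝ • (y : ∀ _, F) i‖ := by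
    simpa [norm_smul] using (key x).1
  let T : E →ₗ[ℝ] F :=
    { toFun := fun x => ∑' i, ⟪stdBasis E i, x⟫_ℝ • (y : ∀ _, F) i
      map_add' := fun x x' => by
        simp only [inner_add_right, add_smul]
        exact (hs x).of_norm.tsum_add (hs x').of_norm
      map_smul' := fun c x => by
        simp only [inner_smul_right, mul_smul, RingHom.id_apply]
        exact (hs x).of_norm.tsum_const_smul c }
  let T' : E →L[ℝ] F := T.mkContinuous (√(∑' i, ‖(y : ∀ _, F) i‖ ^ 2)) fun x => by
    refine (norm_tsum_le_tsum_norm (hs x)).trans ?_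
    have h1 : ∑' i, |⟪stdBasis E i, x⟫_ℝ| ^ 2 = ‖x‖ ^ 2 := by
      simpa using (hasSum_sq_inner (stdBasis E) x).tsum_eq
    have := (key x).2
    rw [h1, Real.sqrt_sq (norm_nonneg x), mul_comm] at this
    simpa [norm_smul] using this
  have hT (i) : T' (stdBasis E i) = (y : ∀ _, F) i := by
    classical
    change ∑' j, ⟪stdBasis E j, stdBasis E i⟫_ℝ • (y : ∀ _, F) j = _
    rw [tsum_eq_single i]
    · simp [(stdBasis E).orthonormal.1 i]
    · intro j hj
      rw [(stdBasis E).orthonormal.2 hj, zero_smul]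
  refine ⟨⟨T', ?_⟩, ?_⟩
  · change Summable fun i => ‖T' (stdBasis E i)‖ ^ 2
    simpa [hT] using hy
  · ext i
    exact hT i

instance [CompleteSpace F] : CompleteSpace (HS E F) := by
  have h : IsUniformInducing (toLp E F) := ⟨rfl⟩
  refine (completeSpace_congr (e := Equiv.ofBijective (toLp E F)
    ⟨toLp_injective, toLp_surjective⟩) h.isUniformEmbedding).2 ?_
  infer_instance

theorem ofReal_norm_sq {ι : Type*} (b : HilbertBasis ι ℝ E) (x : E) :
    ENNReal.ofReal (‖x‖ ^ 2) = ∑' i, ENNReal.ofReal (⟪b i, x⟫_ℝ ^ 2) := by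
  rw [← (hasSum_sq_inner b x).tsum_eq,
    ENNReal.ofReal_tsum_of_nonneg (fun _ => sq_nonneg _) (hasSum_sq_inner b x).summable]

section Basis
variable [CompleteSpace F]

theorem tsum_ofReal_adjoint {ι κ : Type*} (b : HilbertBasis ι ℝ E) (c : HilbertBasis κ ℝ F)
    (T : E →L[ℝ] F) : ∑' i, ENNReal.ofReal (‖T (b i)‖ ^ 2) =
      ∑' j, ENNReal.ofReal (‖ContinuousLinearMap.adjoint T (c j)‖ ^ 2) := by
  simp_rw [ofReal_norm_sq c, ofReal_norm_sq b, ContinuousLinearMap.adjoint_inner_right]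
  rw [ENNReal.tsum_comm]
  simp_rw [real_inner_comm]

theorem tsum_ofReal_eq {ι κ : Type*} (b : HilbertBasis ι ℝ E) (c : HilbertBasis κ ℝ E)
    (T : E →L[ℝ] F) : ∑' i, ENNReal.ofReal (‖T (b i)‖ ^ 2) =
      ∑' j, ENNReal.ofReal (‖T (c j)‖ ^ 2) := by
  rw [tsum_ofReal_adjoint b (stdBasis F), tsum_ofReal_adjoint c (stdBasis F)]

theorem summable_iff_ofReal {ι : Type*} {f : ι → ℝ} (hf : ∀ i, 0 ≤ f i) :
    Summable f ↔ ∑' i, ENNReal.ofReal (f i) ≠ ∞ := by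
  refine ⟨fun h => h.tsum_ofReal_ne_top, fun h => ?_⟩
  have := ENNReal.summable_toReal h
  simpa [ENNReal.toReal_ofReal (hf _)] using this

/-- Being Hilbert-Schmidt does not depend on the orthonormal basis. -/
theorem mem_hilbertSchmidt_iff {ι : Type*} (b : HilbertBasis ι ℝ E) (T : E →L[ℝ] F) :
    T ∈ hilbertSchmidt E F ↔ Summable fun i => ‖T (b i)‖ ^ 2 := by
  rw [summable_iff_ofReal (fun _ => sq_nonneg _), tsum_ofReal_eq b (stdBasis E),
    ← summable_iff_ofReal (fun _ => sq_nonneg _)]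
  rfl

/-- The Hilbert-Schmidt norm does not depend on the orthonormal basis. -/
theorem hasSum_norm_sq {ι : Type*} (b : HilbertBasis ι ℝ E) (T : HS E F) :
    HasSum (fun i => ‖toCLM T (b i)‖ ^ 2) (‖T‖ ^ 2) := by
  have hs := (mem_hilbertSchmidt_iff b (toCLM T)).1 T.2
  have hT : Summable fun i => ‖toCLM T (stdBasis E i)‖ ^ 2 := T.2
  convert hs.hasSum using 1
  rw [norm_sq_eq_tsum, ← ENNReal.ofReal_eq_ofReal_iff (tsum_nonneg fun _ => sq_nonneg _)
    (tsum_nonneg fun _ => sq_nonneg _), ENNReal.ofReal_tsum_of_nonneg (fun _ => sq_nonneg _) hs,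
    ENNReal.ofReal_tsum_of_nonneg (fun _ => sq_nonneg _) hT, tsum_ofReal_eq b (stdBasis E)]

end Basis

end HS
end HilbertSchmidt

section TraceClass

section Nuclear

variable {E F : Type*} [NormedAddCommGroup E] [InnerProductSpace ℝ E]
  [NormedAddCommGroup F] [InnerProductSpace ℝ F]

/-- `T = ∑ ⟪aᵢ, ·⟫ bᵢ` with `∑ ‖aᵢ‖ ‖bᵢ‖ < ∞`. -/
def IsNuclearRep {ι : Type*} (T : E →L[ℝ] F) (a : ι → E) (b : ι → F) : Prop :=
  (Summable fun i => ‖a i‖ * ‖b i‖) ∧ ∀ x, HasSum (fun i => ⟪a i, x⟫_ℝ • b i) (T x)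

theorem IsNuclearRep.exists_nat {ι : Type*} {T : E →L[ℝ] F} {a : ι → E} {b : ι → F}
    (h : IsNuclearRep T a b) : ∃ (a' : ℕ → E) (b' : ℕ → F), IsNuclearRep T a' b' ∧
      ∑' n, ‖a' n‖ * ‖b' n‖ = ∑' i, ‖a i‖ * ‖b i‖ := by
  set s := Function.support fun i => ‖a i‖ * ‖b i‖ with hs
  have hc : s.Countable := h.1.countable_support
  have : Countable s := hc
  obtain ⟨φ, hφ⟩ := exists_injective_nat s
  have e1 : (fun n => ‖Function.extend φ (fun i : s => a i) 0 n‖ *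
      ‖Function.extend φ (fun i : s => b i) 0 n‖) =
      Function.extend φ (fun i : s => ‖a i‖ * ‖b i‖) 0 := by
    funext n
    by_cases hn : ∃ i, φ i = n
    · obtain ⟨i, rfl⟩ := hn
      simp [hφ.extend_apply]
    · simp [Function.extend_apply' _ _ _ hn]
  have e2 (x : E) : (fun n => ⟪Function.extend φ (fun i : s => a i) 0 n, x⟫_ℝ •
      Function.extend φ (fun i : s => b i) 0 n) =
      Function.extend φ (fun i : s => ⟪a i, x⟫_ℝ • b i) 0 := by
    funext n
    by_cases hn : ∃ i, φ i = n
    · obtain ⟨i, rfl⟩ := hn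
      simp [hφ.extend_apply]
    · simp [Function.extend_apply' _ _ _ hn]
  have h1 : HasSum (fun n => ‖Function.extend φ (fun i : s => a i) 0 n‖ *
      ‖Function.extend φ (fun i : s => b i) 0 n‖) (∑' i, ‖a i‖ * ‖b i‖) := by
    rw [e1, hasSum_extend_zero hφ]
    exact (hasSum_subtype_iff_of_support_subset (f := fun i => ‖a i‖ * ‖b i‖)
      (s := s) subset_rfl).2 h.1.hasSum
  refine ⟨_, _, ⟨h1.summable, fun x => ?_⟩, h1.tsum_eq⟩
  rw [e2, hasSum_extend_zero hφ]
  refine (hasSum_subtype_iff_of_support_subset (f := fun i => ⟪a i, x⟫_ℝ • b i)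
      (s := s) ?_).2 (h.2 x)
  intro i hi
  simp only [Function.mem_support, ne_eq, smul_eq_zero, not_or, hs, mul_eq_zero,
    norm_eq_zero] at hi ⊢
  exact ⟨fun h0 => hi.1 (by simp [h0]), hi.2⟩

theorem IsNuclearRep.add {ι κ : Type*} {S T : E →L[ℝ] F} {a : ι → E} {b : ι → F}
    {a' : κ → E} {b' : κ → F} (hS : IsNuclearRep S a b) (hT : IsNuclearRep T a' b') :
    IsNuclearRep (S + T) (Sum.elim a a') (Sum.elim b b') ∧
      ∑' i, ‖Sum.elim a a' i‖ * ‖Sum.elim b b' i‖ =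
        ∑' i, ‖a i‖ * ‖b i‖ + ∑' i, ‖a' i‖ * ‖b' i‖ := by
  have h : HasSum (fun i => ‖Sum.elim a a' i‖ * ‖Sum.elim b b' i‖)
      (∑' i, ‖a i‖ * ‖b i‖ + ∑' i, ‖a' i‖ * ‖b' i‖) :=
    HasSum.sum hS.1.hasSum hT.1.hasSum
  exact ⟨⟨h.summable, fun x => HasSum.sum (hS.2 x) (hT.2 x)⟩, h.tsum_eq⟩

theorem IsNuclearRep.smul {ι : Type*} {T : E →L[ℝ] F} {a : ι → E} {b : ι → F} (c : ℝ)
    (hT : IsNuclearRep T a b) : IsNuclearRep (c • T) a (fun i => c • b i) ∧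
      ∑' i, ‖a i‖ * ‖c • b i‖ = |c| * ∑' i, ‖a i‖ * ‖b i‖ := by
  have h : HasSum (fun i => ‖a i‖ * ‖c • b i‖) (|c| * ∑' i, ‖a i‖ * ‖b i‖) := by
    simpa [norm_smul, mul_left_comm] using hT.1.hasSum.mul_left |c|
  refine ⟨⟨h.summable, fun x => ?_⟩, h.tsum_eq⟩
  simpa [smul_comm c] using (hT.2 x).const_smul c

theorem IsNuclearRep.norm_le {ι : Type*} {T : E →L[ℝ] F} {a : ι → E} {b : ι → F}
    (hT : IsNuclearRep T a b) : ‖T‖ ≤ ∑' i, ‖a i‖ * ‖b i‖ := by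
  refine T.opNorm_le_bound (tsum_nonneg fun _ => by positivity) fun x => ?_
  rw [← (hT.2 x).tsum_eq, ← tsum_mul_right]
  refine tsum_of_norm_bounded (hT.1.mul_right ‖x‖).hasSum fun i => ?_
  rw [norm_smul, mul_right_comm]
  gcongr
  exact norm_inner_le_norm _ _

variable (E F)

/-- The trace-class (nuclear) operators. -/
def traceClass : Submodule ℝ (E →L[ℝ] F) where
  carrier := {T | ∃ (a : ℕ → E) (b : ℕ → F), IsNuclearRep T a b}
  add_mem' := by
    rintro S T ⟨a, b, h⟩ ⟨a', b', h'⟩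
    obtain ⟨c, d, hcd, -⟩ := (h.add h').1.exists_nat
    exact ⟨c, d, hcd⟩
  zero_mem' := ⟨0, 0, by simp [IsNuclearRep, summable_zero, hasSum_zero]⟩
  smul_mem' := by
    rintro c T ⟨a, b, h⟩
    exact ⟨_, _, (h.smul c).1⟩

/-- The space `S₁(E, F)` of trace-class operators. Its norm `‖T‖₁` is the infimum of
`∑ ‖aₙ‖ ‖bₙ‖` over all representations `T = ∑ ⟪aₙ, ·⟫ bₙ`; see `mem_traceClass_iff_of_svd` and
`norm_eq_tsum_of_svd` below: in terms of the singular values `σᵢ` of `T`, membership means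
`∑ σᵢ < ∞`, and `‖T‖₁ = ∑ σᵢ`. -/
def TC : Type _ := ↥(traceClass E F)

instance : AddCommGroup (TC E F) := inferInstanceAs (AddCommGroup ↥(traceClass E F))
instance : Module ℝ (TC E F) := inferInstanceAs (Module ℝ ↥(traceClass E F))

end Nuclear

namespace TC

section Norm

variable {E F : Type*} [NormedAddCommGroup E] [InnerProductSpace ℝ E]
  [NormedAddCommGroup F] [InnerProductSpace ℝ F]

/-- The bounded operator underlying a trace-class operator. -/
def toCLM : TC E F →ₗ[ℝ] (E →L[ℝ] F) := (traceClass E F).subtype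

theorem toCLM_injective : Function.Injective (toCLM (E := E) (F := F)) := Subtype.val_injective

theorem exists_rep (T : TC E F) : ∃ (a : ℕ → E) (b : ℕ → F), IsNuclearRep (toCLM T) a b := T.2

/-- The values `∑ ‖aₙ‖ ‖bₙ‖` over all nuclear representations of `T`. -/
def repSums (T : TC E F) : Set ℝ :=
  {r | ∃ (a : ℕ → E) (b : ℕ → F), IsNuclearRep (toCLM T) a b ∧ r = ∑' n, ‖a n‖ * ‖b n‖}

/-- The trace norm `‖T‖₁`. -/
def traceNorm (T : TC E F) : ℝ := sInf (repSums T)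

theorem repSums_nonempty (T : TC E F) : (repSums T).Nonempty := by
  obtain ⟨a, b, h⟩ := exists_rep T
  exact ⟨_, a, b, h, rfl⟩

theorem norm_toCLM_le_of_mem {T : TC E F} {r : ℝ} (h : r ∈ repSums T) : ‖toCLM T‖ ≤ r := by
  obtain ⟨a, b, h, rfl⟩ := h
  exact h.norm_le

theorem repSums_bddBelow (T : TC E F) : BddBelow (repSums T) :=
  ⟨_, fun _ h => norm_toCLM_le_of_mem h⟩

theorem norm_toCLM_le' (T : TC E F) : ‖toCLM T‖ ≤ traceNorm T :=
  le_csInf (repSums_nonempty T) fun _ h => norm_toCLM_le_of_mem h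

theorem traceNorm_le_of_rep {ι : Type*} {T : TC E F} {a : ι → E} {b : ι → F}
    (h : IsNuclearRep (toCLM T) a b) : traceNorm T ≤ ∑' i, ‖a i‖ * ‖b i‖ := by
  obtain ⟨a', b', h', e⟩ := h.exists_nat
  exact csInf_le (repSums_bddBelow T) ⟨a', b', h', e.symm⟩

theorem traceNorm_smul_le (c : ℝ) (T : TC E F) : traceNorm (c • T) ≤ |c| * traceNorm T := by
  have h : ∀ r ∈ repSums T, traceNorm (c • T) ≤ |c| * r := by
    rintro r ⟨a, b, h, rfl⟩
    rw [← (h.smul c).2]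
    exact traceNorm_le_of_rep (by simpa using (h.smul c).1)
  obtain ⟨r₀, hr₀⟩ := repSums_nonempty T
  rcases eq_or_ne c 0 with rfl | hc
  · simpa using h r₀ hr₀
  · have hc' : 0 < |c| := abs_pos.2 hc
    rw [← div_le_iff₀' hc']
    exact le_csInf (repSums_nonempty T) fun r hr => (div_le_iff₀' hc').2 (h r hr)

theorem traceNorm_add_le (S T : TC E F) : traceNorm (S + T) ≤ traceNorm S + traceNorm T := by
  refine le_of_forall_pos_le_add fun ε hε => ?_
  obtain ⟨r, ⟨a, b, h, rfl⟩, hr⟩ := exists_lt_of_csInf_lt (repSums_nonempty S)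
    (lt_add_of_pos_right (traceNorm S) (half_pos hε))
  obtain ⟨r', ⟨a', b', h', rfl⟩, hr'⟩ := exists_lt_of_csInf_lt (repSums_nonempty T)
    (lt_add_of_pos_right (traceNorm T) (half_pos hε))
  have := traceNorm_le_of_rep (T := S + T) (by simpa using (h.add h').1)
  rw [(h.add h').2] at this
  linarith

instance : NormedAddCommGroup (TC E F) :=
  AddGroupNorm.toNormedAddCommGroup
    { toFun := traceNorm
      map_zero' := le_antisymm (by simpa using traceNorm_smul_le 0 (0 : TC E F))
        ((norm_nonneg _).trans (norm_toCLM_le' 0))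
      add_le' := traceNorm_add_le
      neg' := fun T => le_antisymm (by simpa using traceNorm_smul_le (-1) T)
        (by simpa using traceNorm_smul_le (-1) (-T))
      eq_zero_of_map_eq_zero' := fun T hT => by
        apply toCLM_injective
        have := norm_toCLM_le' T
        rw [hT] at this
        simpa using norm_le_zero_iff.1 this }

theorem norm_def (T : TC E F) : ‖T‖ = traceNorm T := rfl

instance : NormedSpace ℝ (TC E F) where
  norm_smul_le c T := traceNorm_smul_le c T

theorem norm_toCLM_le (T : TC E F) : ‖toCLM T‖ ≤ ‖T‖ := norm_toCLM_le' T

end Norm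


section SingularValues

variable {E F : Type*} [NormedAddCommGroup E] [InnerProductSpace ℝ E]
  [NormedAddCommGroup F] [InnerProductSpace ℝ F]

theorem sum_inner_mul_inner_le {ι : Type*} {e : ι → E} {f : ι → F} (he : Orthonormal ℝ e)
    (hf : Orthonormal ℝ f) (s : Finset ι) (x : E) (y : F) :
    ∑ i ∈ s, |⟪x, e i⟫_ℝ| * |⟪y, f i⟫_ℝ| ≤ ‖x‖ * ‖y‖ := by
  have h1 : ∑ i ∈ s, ⟪x, e i⟫_ℝ ^ 2 ≤ ‖x‖ ^ 2 := by
    simpa [real_inner_comm] using he.sum_inner_products_le (s := s) x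
  have h2 : ∑ i ∈ s, ⟪y, f i⟫_ℝ ^ 2 ≤ ‖y‖ ^ 2 := by
    simpa [real_inner_comm] using hf.sum_inner_products_le (s := s) y
  refine (Real.sum_mul_le_sqrt_mul_sqrt s _ _).trans ?_
  simp only [sq_abs]
  gcongr
  · exact (Real.sqrt_le_left (norm_nonneg x)).2 h1
  · exact (Real.sqrt_le_left (norm_nonneg y)).2 h2

theorem sum_le_of_rep {ι : Type*} {σ : ι → ℝ} {e : ι → E} {f : ι → F}
    (he : Orthonormal ℝ e) (hf : Orthonormal ℝ f) {T : E →L[ℝ] F}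
    (hT : ∀ i, T (e i) = σ i • f i) {κ : Type*} {a : κ → E} {b : κ → F} (h : IsNuclearRep T a b)
    (s : Finset ι) : ∑ i ∈ s, σ i ≤ ∑' n, ‖a n‖ * ‖b n‖ := by
  have h1 (i : ι) : HasSum (fun n => ⟪a n, e i⟫_ℝ * ⟪f i, b n⟫_ℝ) (σ i) := by
    have := (h.2 (e i)).mapL (innerSL ℝ (f i))
    simpa [hT, inner_smul_right, hf.1 i] using this
  have h2 := hasSum_sum (s := s) fun i _ => h1 i
  refine hasSum_le (fun n => ?_) h2 h.1.hasSum
  refine (Finset.sum_le_sum fun i _ => ?_).trans (sum_inner_mul_inner_le he hf s (a n) (b n))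
  rw [real_inner_comm (b n), ← abs_mul]
  exact le_abs_self _

/-- Agreement with the singular values: if `T = ∑ σᵢ ⟪eᵢ, ·⟫ fᵢ` is a singular value decomposition,
then `T` is trace-class if and only if `∑ σᵢ < ∞`. -/
theorem mem_traceClass_iff_of_svd {ι : Type*} {σ : ι → ℝ} (hσ : ∀ i, 0 ≤ σ i) {e : ι → E}
    {f : ι → F} (he : Orthonormal ℝ e) (hf : Orthonormal ℝ f) {T : E →L[ℝ] F}
    (hT : ∀ x, HasSum (fun i => (σ i * ⟪e i, x⟫_ℝ) • f i) (T x)) :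
    T ∈ traceClass E F ↔ Summable σ := by
  classical
  have hTe (i : ι) : T (e i) = σ i • f i := by
    rw [← (hT (e i)).tsum_eq, tsum_eq_single i]
    · simp [he.1 i]
    · intro j hj
      simp [he.2 hj]
  constructor
  · rintro ⟨a, b, h⟩
    exact summable_of_sum_le hσ (sum_le_of_rep he hf hTe h)
  · intro h
    have hr : IsNuclearRep T (fun i => σ i • e i) f := by
      refine ⟨by simpa [norm_smul, he.1, hf.1, abs_of_nonneg (hσ _)] using h, fun x => ?_⟩
      simpa [inner_smul_left] using hT x
    obtain ⟨a, b, h, -⟩ := hr.exists_nat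
    exact ⟨a, b, h⟩

/-- Agreement with the singular values: if `T = ∑ σᵢ ⟪eᵢ, ·⟫ fᵢ` is a singular value decomposition
of a trace-class operator, then `‖T‖₁ = ∑ σᵢ`. -/
theorem norm_eq_tsum_of_svd {ι : Type*} {σ : ι → ℝ} (hσ : ∀ i, 0 ≤ σ i) {e : ι → E}
    {f : ι → F} (he : Orthonormal ℝ e) (hf : Orthonormal ℝ f) (T : TC E F)
    (hT : ∀ x, HasSum (fun i => (σ i * ⟪e i, x⟫_ℝ) • f i) (toCLM T x)) :
    ‖T‖ = ∑' i, σ i := by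
  classical
  have hs := (mem_traceClass_iff_of_svd hσ he hf hT).1 T.2
  have hTe (i : ι) : toCLM T (e i) = σ i • f i := by
    rw [← (hT (e i)).tsum_eq, tsum_eq_single i]
    · simp [he.1 i]
    · intro j hj
      simp [he.2 hj]
  refine le_antisymm ?_ ?_
  · have hr : IsNuclearRep (toCLM T) (fun i => σ i • e i) f := by
      refine ⟨by simpa [norm_smul, he.1, hf.1, abs_of_nonneg (hσ _)] using hs, fun x => ?_⟩
      simpa [inner_smul_left] using hT x
    refine (traceNorm_le_of_rep hr).trans_eq ?_
    simp [norm_smul, he.1, hf.1, abs_of_nonneg (hσ _)]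
  · refine le_csInf (repSums_nonempty T) ?_
    rintro r ⟨a, b, h, rfl⟩
    exact hs.tsum_le_of_sum_le (sum_le_of_rep he hf hTe h)

end SingularValues

section Trace

variable {E F : Type*} [NormedAddCommGroup E] [InnerProductSpace ℝ E] [CompleteSpace E]
  [NormedAddCommGroup F] [InnerProductSpace ℝ F]

/-- The trace `Tr T = ∑ ⟪T eᵢ, eᵢ⟫` of a trace-class operator. -/
def trace (T : TC E E) : ℝ := ∑' i, ⟪toCLM T (stdBasis E i), stdBasis E i⟫_ℝ

theorem hasSum_trace_of_rep {ι κ : Type*} (e : HilbertBasis ι ℝ E) {T : E →L[ℝ] E} {a b : κ → E}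
    (h : IsNuclearRep T a b) : HasSum (fun i => ⟪T (e i), e i⟫_ℝ) (∑' n, ⟪a n, b n⟫_ℝ) := by
  have hs : Summable fun p : κ × ι => ⟪a p.1, e p.2⟫_ℝ * ⟪e p.2, b p.1⟫_ℝ := by
    refine Summable.of_norm ?_
    have hle (n : κ) (s : Finset ι) :
        ∑ i ∈ s, ‖⟪a n, e i⟫_ℝ * ⟪e i, b n⟫_ℝ‖ ≤ ‖a n‖ * ‖b n‖ := by
      simpa [real_inner_comm] using
        sum_inner_mul_inner_le e.orthonormal e.orthonormal s (a n) (b n)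
    rw [summable_prod_of_nonneg fun _ => norm_nonneg _]
    have hs1 (n : κ) : Summable fun i => ‖⟪a n, e i⟫_ℝ * ⟪e i, b n⟫_ℝ‖ :=
      summable_of_sum_le (fun _ => norm_nonneg _) (hle n)
    refine ⟨hs1, Summable.of_nonneg_of_le (fun _ => tsum_nonneg fun _ => norm_nonneg _)
      (fun n => (hs1 n).tsum_le_of_sum_le (hle n)) h.1⟩
  have h1 : HasSum (fun p : κ × ι => ⟪a p.1, e p.2⟫_ℝ * ⟪e p.2, b p.1⟫_ℝ)
      (∑' n, ⟪a n, b n⟫_ℝ) := by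
    have h2 := hs.hasSum.prod_fiberwise fun n => e.hasSum_inner_mul_inner (a n) (b n)
    rw [h2.tsum_eq]
    exact hs.hasSum
  have h3 := (Equiv.prodComm ι κ).hasSum_iff.2 h1
  refine h3.prod_fiberwise fun i => ?_
  have := (h.2 (e i)).mapL (innerSL ℝ (e i))
  simpa [inner_smul_right, real_inner_comm] using this

/-- The trace does not depend on the orthonormal basis. -/
theorem hasSum_trace {ι : Type*} (e : HilbertBasis ι ℝ E) (T : TC E E) :
    HasSum (fun i => ⟪toCLM T (e i), e i⟫_ℝ) (trace T) := by
  obtain ⟨a, b, h⟩ := exists_rep T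
  rw [trace, (hasSum_trace_of_rep (stdBasis E) h).tsum_eq]
  exact hasSum_trace_of_rep e h

theorem trace_eq_of_rep {κ : Type*} (T : TC E E) {a b : κ → E} (h : IsNuclearRep (toCLM T) a b) :
    trace T = ∑' n, ⟪a n, b n⟫_ℝ :=
  (hasSum_trace_of_rep (stdBasis E) h).tsum_eq

variable (E F) in
theorem traceClass_le_hilbertSchmidt : traceClass E F ≤ hilbertSchmidt E F := by
  rintro T ⟨a, b, h⟩
  set N := ∑' n, ‖a n‖ * ‖b n‖ with hN
  have hN0 : 0 ≤ N := tsum_nonneg fun _ => by positivity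
  refine summable_of_sum_le (c := N ^ 2) (fun _ => sq_nonneg _) fun s => ?_
  set S := ∑ i ∈ s, ‖T (stdBasis E i)‖ ^ 2 with hS
  have hS0 : 0 ≤ S := Finset.sum_nonneg fun _ _ => sq_nonneg _
  have h1 : HasSum (fun n => ∑ i ∈ s, ⟪a n, stdBasis E i⟫_ℝ * ⟪T (stdBasis E i), b n⟫_ℝ) S := by
    refine hasSum_sum fun i _ => ?_
    have := (h.2 (stdBasis E i)).mapL (innerSL ℝ (T (stdBasis E i)))
    simpa [inner_smul_right] using this
  have h2 : S ≤ N * √S := by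
    refine hasSum_le (fun n => ?_) h1 (h.1.hasSum.mul_right (√S))
    refine (Finset.sum_le_sum fun i _ => le_abs_self _).trans ?_
    have h3 : ∑ i ∈ s, |⟪a n, stdBasis E i⟫_ℝ| * ‖T (stdBasis E i)‖ ≤ ‖a n‖ * √S := by
      refine (Real.sum_mul_le_sqrt_mul_sqrt s _ _).trans ?_
      gcongr
      refine (Real.sqrt_le_left (norm_nonneg _)).2 ?_
      simpa [real_inner_comm] using (stdBasis E).orthonormal.sum_inner_products_le (s := s) (a n)
    calc _ ≤ ∑ i ∈ s, ‖b n‖ * (|⟪a n, stdBasis E i⟫_ℝ| * ‖T (stdBasis E i)‖) := by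
          refine Finset.sum_le_sum fun i _ => ?_
          rw [abs_mul, mul_left_comm, mul_comm ‖b n‖]
          gcongr
          exact abs_real_inner_le_norm _ _
      _ ≤ ‖a n‖ * ‖b n‖ * √S := by
          rw [← Finset.mul_sum]
          nlinarith [norm_nonneg (b n)]
  have h4 : √S ≤ N := by
    by_contra hlt
    push Not at hlt
    have := Real.mul_self_sqrt hS0
    nlinarith [Real.sqrt_nonneg S]
  nlinarith [Real.mul_self_sqrt hS0, Real.sqrt_nonneg S]

/-- A trace-class operator, regarded as a Hilbert-Schmidt operator. -/
def toHS (T : TC E F) : HS E F := ⟨toCLM T, traceClass_le_hilbertSchmidt E F T.2⟩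

end Trace

end TC
end TraceClass

section Tensor

/-- `H` is a realization of the tensor product Hilbert space `H₁ ⊗ H₂`: a bilinear map
`(x, y) ↦ x ⊗ y` into `H` with `⟪x ⊗ y, x' ⊗ y'⟫ = ⟪x, x'⟫ ⟪y, y'⟫`, whose range spans a
dense subspace. -/
class HilbertTensor (H₁ H₂ H : Type*) [NormedAddCommGroup H₁] [InnerProductSpace ℝ H₁]
    [NormedAddCommGroup H₂] [InnerProductSpace ℝ H₂]
    [NormedAddCommGroup H] [InnerProductSpace ℝ H] where
  /-- The simple tensors. -/
  tmul : H₁ →ₗ[ℝ] H₂ →ₗ[ℝ] H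
  inner_tmul : ∀ x y x' y', ⟪tmul x y, tmul x' y'⟫_ℝ = ⟪x, x'⟫_ℝ * ⟪y, y'⟫_ℝ
  dense_tmul : Dense (Submodule.span ℝ (Set.range fun p : H₁ × H₂ => tmul p.1 p.2) : Set H)

open HilbertTensor

variable {H₁ H₂ H : Type*} [NormedAddCommGroup H₁] [InnerProductSpace ℝ H₁]
  [NormedAddCommGroup H₂] [InnerProductSpace ℝ H₂]
  [NormedAddCommGroup H] [InnerProductSpace ℝ H] [HilbertTensor H₁ H₂ H]

theorem norm_tmul (x : H₁) (y : H₂) : ‖(tmul x y : H)‖ = ‖x‖ * ‖y‖ := by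
  rw [← sq_eq_sq₀ (norm_nonneg _) (by positivity), mul_pow, ← real_inner_self_eq_norm_sq,
    inner_tmul, real_inner_self_eq_norm_sq, real_inner_self_eq_norm_sq]

theorem clm_ext_tmul {G : Type*} [NormedAddCommGroup G] [NormedSpace ℝ G] {S T : H →L[ℝ] G}
    (h : ∀ (x : H₁) (y : H₂), S (tmul x y) = T (tmul x y)) : S = T := by
  refine ContinuousLinearMap.ext_on (dense_tmul (H₁ := H₁) (H₂ := H₂)) ?_
  rintro _ ⟨p, rfl⟩
  exact h p.1 p.2

variable (H₁ H₂ H) in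
/-- The isometric embedding of the algebraic tensor product. -/
def embed : TensorProduct ℝ H₁ H₂ →ₗᵢ[ℝ] H :=
  (TensorProduct.lift (tmul : H₁ →ₗ[ℝ] H₂ →ₗ[ℝ] H)).isometryOfInner fun u v => by
    induction u with
    | zero => simp
    | add u u' hu hu' => simp [inner_add_left, hu, hu']
    | tmul x y =>
      induction v with
      | zero => simp
      | add v v' hv hv' => rw [map_add, inner_add_right, inner_add_right, hv, hv']
      | tmul x' y' => simp [inner_tmul]

@[simp] theorem embed_tmul (x : H₁) (y : H₂) :
    embed H₁ H₂ H (TensorProduct.tmul ℝ x y) = tmul x y := rfl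

variable (H₁ H₂ H) in
theorem denseRange_embed : DenseRange (embed H₁ H₂ H).toLinearMap := by
  refine (dense_tmul (H₁ := H₁) (H₂ := H₂) (H := H)).mono ?_
  change _ ≤ LinearMap.range (embed H₁ H₂ H).toLinearMap
  rw [Submodule.span_le]
  rintro _ ⟨p, rfl⟩
  exact ⟨TensorProduct.tmul ℝ p.1 p.2, rfl⟩

section Operators

variable [CompleteSpace H]

/-- The tensor product `A ⊗ B` of bounded operators: the bounded operator on `H₁ ⊗ H₂` with
`(A ⊗ B) (x ⊗ y) = A x ⊗ B y`. -/
def opTensor (A : H₁ →L[ℝ] H₁) (B : H₂ →L[ℝ] H₂) : H →L[ℝ] H :=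
  ((embed H₁ H₂ H).toLinearMap ∘ₗ (TensorProduct.mapL A B).toLinearMap).extendOfNorm
    (embed H₁ H₂ H).toLinearMap

theorem opTensor_tmul (A : H₁ →L[ℝ] H₁) (B : H₂ →L[ℝ] H₂) (x : H₁) (y : H₂) :
    opTensor A B (tmul x y : H) = tmul (A x) (B y) := by
  have h := LinearMap.extendOfNorm_eq
    (f := (embed H₁ H₂ H).toLinearMap ∘ₗ (TensorProduct.mapL A B).toLinearMap)
    (denseRange_embed H₁ H₂ H) ⟨‖TensorProduct.mapL A B‖, fun u => by
      simpa using (TensorProduct.mapL A B).le_opNorm u⟩ (TensorProduct.tmul ℝ x y)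
  exact h

theorem opTensor_unique {A : H₁ →L[ℝ] H₁} {B : H₂ →L[ℝ] H₂} {T : H →L[ℝ] H}
    (h : ∀ x y, T (tmul x y) = tmul (A x) (B y)) : opTensor A B = T :=
  clm_ext_tmul fun x y => by rw [opTensor_tmul, h]

end Operators

section Slices

/-- `y ↦ x ⊗ y`. -/
def tmulL (x : H₁) : H₂ →L[ℝ] H :=
  (tmul x : H₂ →ₗ[ℝ] H).mkContinuous ‖x‖ fun y => (norm_tmul x y).le

/-- `x ↦ x ⊗ y`. -/
def tmulR (y : H₂) : H₁ →L[ℝ] H :=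
  ((tmul : H₁ →ₗ[ℝ] H₂ →ₗ[ℝ] H).flip y).mkContinuous ‖y‖ fun x => by
    rw [mul_comm]; exact (norm_tmul x y).le

@[simp] theorem tmulL_apply (x : H₁) (y : H₂) : (tmulL x y : H) = tmul x y := rfl
@[simp] theorem tmulR_apply (x : H₁) (y : H₂) : (tmulR y x : H) = tmul x y := rfl

end Slices

end Tensor

section Compress

variable {K H ι : Type*} [NormedAddCommGroup K] [InnerProductSpace ℝ K] [CompleteSpace K]
  [NormedAddCommGroup H] [InnerProductSpace ℝ H] [CompleteSpace H]

/-- Isometries `Jᵢ` with mutually orthogonal ranges. -/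
def OrthIsometries (J : ι → K →L[ℝ] H) : Prop :=
  (∀ i x y, ⟪J i x, J i y⟫_ℝ = ⟪x, y⟫_ℝ) ∧ ∀ i j, i ≠ j → ∀ x y, ⟪J i x, J j y⟫_ℝ = 0

open ContinuousLinearMap in
theorem OrthIsometries.bessel {J : ι → K →L[ℝ] H} (hJ : OrthIsometries J) (s : Finset ι) (z : H) :
    ∑ i ∈ s, ‖adjoint (J i) z‖ ^ 2 ≤ ‖z‖ ^ 2 := by
  classical
  set S := ∑ i ∈ s, ‖adjoint (J i) z‖ ^ 2 with hS
  set p := ∑ i ∈ s, J i (adjoint (J i) z) with hp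
  have h1 : ⟪p, z⟫_ℝ = S := by
    rw [hp, sum_inner]
    refine Finset.sum_congr rfl fun i _ => ?_
    rw [← adjoint_inner_right, real_inner_self_eq_norm_sq]
  have h2 : ⟪p, p⟫_ℝ = S := by
    rw [hp, sum_inner]
    refine Finset.sum_congr rfl fun i hi => ?_
    rw [inner_sum, Finset.sum_eq_single i, hJ.1, real_inner_self_eq_norm_sq]
    · intro j _ hj
      exact hJ.2 i j hj.symm _ _
    · exact fun h => absurd hi h
  have h3 : 0 ≤ ⟪z - p, z - p⟫_ℝ := real_inner_self_nonneg
  rw [inner_sub_left, inner_sub_right, inner_sub_right, h2, h1, real_inner_comm p z, h1,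
    real_inner_self_eq_norm_sq] at h3
  linarith

open ContinuousLinearMap in
/-- The operator `∑ᵢ Jᵢ* T Jᵢ`. -/
def compressCLM (J : ι → K →L[ℝ] H) (T : H →L[ℝ] H) : K →L[ℝ] K :=
  ∑' i, adjoint (J i) ∘L T ∘L J i

open ContinuousLinearMap in
theorem compress_rep {J : ι → K →L[ℝ] H} (hJ : OrthIsometries J) {κ : Type*} {T : H →L[ℝ] H}
    {a b : κ → H} (h : IsNuclearRep T a b) :
    (Summable fun i => adjoint (J i) ∘L T ∘L J i) ∧
    IsNuclearRep (compressCLM J T) (fun p : κ × ι => adjoint (J p.2) (a p.1))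
      (fun p => adjoint (J p.2) (b p.1)) := by
  have hle (n : κ) (s : Finset ι) :
      ∑ i ∈ s, ‖adjoint (J i) (a n)‖ * ‖adjoint (J i) (b n)‖ ≤ ‖a n‖ * ‖b n‖ := by
    refine (Real.sum_mul_le_sqrt_mul_sqrt s _ _).trans ?_
    gcongr
    · exact (Real.sqrt_le_left (norm_nonneg _)).2 (hJ.bessel s _)
    · exact (Real.sqrt_le_left (norm_nonneg _)).2 (hJ.bessel s _)
  have hs : Summable fun p : κ × ι => ‖adjoint (J p.2) (a p.1)‖ * ‖adjoint (J p.2) (b p.1)‖ := by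
    rw [summable_prod_of_nonneg fun _ => by positivity]
    have hs1 (n : κ) : Summable fun i => ‖adjoint (J i) (a n)‖ * ‖adjoint (J i) (b n)‖ :=
      summable_of_sum_le (fun _ => by positivity) (hle n)
    exact ⟨hs1, Summable.of_nonneg_of_le (fun _ => tsum_nonneg fun _ => by positivity)
      (fun n => (hs1 n).tsum_le_of_sum_le (hle n)) h.1⟩
  have hs' : Summable fun q : ι × κ => ‖adjoint (J q.1) (a q.2)‖ * ‖adjoint (J q.1) (b q.2)‖ :=
    (Equiv.prodComm ι κ).summable_iff.2 hs
  have hterm (i : ι) : IsNuclearRep (adjoint (J i) ∘L T ∘L J i) (fun n => adjoint (J i) (a n))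
      (fun n => adjoint (J i) (b n)) := by
    refine ⟨(hs'.prod_factor i), fun x => ?_⟩
    have := (h.2 (J i x)).mapL (adjoint (J i))
    simpa [adjoint_inner_left] using this
  have hsum : Summable fun i => adjoint (J i) ∘L T ∘L J i :=
    Summable.of_norm_bounded hs'.prod fun i => (hterm i).norm_le
  refine ⟨hsum, hs, fun x => ?_⟩
  have h1 : Summable fun p : κ × ι => ⟪adjoint (J p.2) (a p.1), x⟫_ℝ • adjoint (J p.2) (b p.1) := by
    refine Summable.of_norm_bounded (hs.mul_right ‖x‖) fun p => ?_
    rw [norm_smul, mul_right_comm]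
    gcongr
    exact norm_inner_le_norm _ _
  have h2 := (Equiv.prodComm ι κ).hasSum_iff.2 h1.hasSum
  have h3 := h2.prod_fiberwise fun i => (hterm i).2 x
  have h4 := hsum.hasSum.mapL (ContinuousLinearMap.apply ℝ K x)
  have h5 := h3.unique h4
  have h6 := h1.hasSum
  rw [h5] at h6
  exact h6

/-- The operator `∑ᵢ Jᵢ* T Jᵢ` for trace-class `T`. -/
def compress {J : ι → K →L[ℝ] H} (hJ : OrthIsometries J) (T : TC H H) : TC K K :=
  ⟨compressCLM J (TC.toCLM T), by
    obtain ⟨a, b, h⟩ := T.exists_rep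
    obtain ⟨a', b', h', -⟩ := (compress_rep hJ h).2.exists_nat
    exact ⟨a', b', h'⟩⟩

end Compress

section TensorClasses

open HilbertTensor

variable {H₁ H₂ H : Type*} [NormedAddCommGroup H₁] [InnerProductSpace ℝ H₁] [CompleteSpace H₁]
  [NormedAddCommGroup H₂] [InnerProductSpace ℝ H₂] [CompleteSpace H₂]
  [NormedAddCommGroup H] [InnerProductSpace ℝ H] [CompleteSpace H] [HilbertTensor H₁ H₂ H]

section TraceClass

theorem opTensor_rep {ι κ : Type*} {A : H₁ →L[ℝ] H₁} {B : H₂ →L[ℝ] H₂} {a b : ι → H₁}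
    {c d : κ → H₂} (hA : IsNuclearRep A a b) (hB : IsNuclearRep B c d) :
    IsNuclearRep (opTensor A B : H →L[ℝ] H) (fun p : ι × κ => tmul (a p.1) (c p.2))
      (fun p => tmul (b p.1) (d p.2)) := by
  have hs : Summable fun p : ι × κ => ‖(tmul (a p.1) (c p.2) : H)‖ * ‖(tmul (b p.1) (d p.2) : H)‖ := by
    simp_rw [norm_tmul, mul_mul_mul_comm]
    exact hA.1.mul_of_nonneg hB.1 (fun _ => by positivity) (fun _ => by positivity)
  have hop : Summable fun p : ι × κ =>
      InnerProductSpace.rankOne ℝ (tmul (b p.1) (d p.2) : H) (tmul (a p.1) (c p.2) : H) := by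
    refine Summable.of_norm ?_
    simpa [mul_comm] using hs
  have hR (z : H) := hop.hasSum.mapL (ContinuousLinearMap.apply ℝ H z)
  simp only [ContinuousLinearMap.apply_apply, InnerProductSpace.rankOne_apply] at hR
  have hE : opTensor A B = ∑' p : ι × κ,
      InnerProductSpace.rankOne ℝ (tmul (b p.1) (d p.2) : H) (tmul (a p.1) (c p.2) : H) := by
    refine opTensor_unique fun x y => ?_
    have h1 (i : ι) : HasSum (fun k => ⟪(tmul (a i) (c k) : H), tmul x y⟫_ℝ • (tmul (b i) (d k) : H))
        (⟪a i, x⟫_ℝ • tmul (b i) (B y)) := by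
      have := ((hB.2 y).mapL (tmulL (H := H) (b i))).const_smul ⟪a i, x⟫_ℝ
      simpa [inner_tmul, mul_smul] using this
    have h2 := (hR (tmul x y)).prod_fiberwise h1
    have h3 := (hA.2 x).mapL (tmulR (H := H) (B y))
    simp only [map_smul, tmulR_apply] at h3
    exact h2.unique h3
  refine ⟨hs, fun z => ?_⟩
  rw [hE]
  exact hR z

/-- The tensor product `A ⊗ B ∈ S₁(H, H)` of trace-class operators. -/
def TC.tensor (A : TC H₁ H₁) (B : TC H₂ H₂) : TC H H :=
  ⟨opTensor (TC.toCLM A) (TC.toCLM B), by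
    obtain ⟨a, b, h⟩ := A.exists_rep
    obtain ⟨c, d, h'⟩ := B.exists_rep
    obtain ⟨u, v, huv, -⟩ := (opTensor_rep h h' : IsNuclearRep (opTensor _ _ : H →L[ℝ] H) _ _).exists_nat
    exact ⟨u, v, huv⟩⟩

variable (H₂ H) in
theorem orthIsometries_tmulL {ι : Type*} {e : ι → H₁} (he : Orthonormal ℝ e) :
    OrthIsometries fun i => (tmulL (e i) : H₂ →L[ℝ] H) :=
  ⟨fun i x y => by simp [inner_tmul, he.1 i], fun i j hij x y => by simp [inner_tmul, he.2 hij]⟩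

variable (H₁ H) in
theorem orthIsometries_tmulR {ι : Type*} {e : ι → H₂} (he : Orthonormal ℝ e) :
    OrthIsometries fun i => (tmulR (e i) : H₁ →L[ℝ] H) :=
  ⟨fun i x y => by simp [inner_tmul, he.1 i], fun i j hij x y => by simp [inner_tmul, he.2 hij]⟩

variable (H₁ H₂) in
/-- The partial trace `Tr₁ : S₁(H, H) → S₁(H₂, H₂)`,
`⟪Tr₁[T] x, y⟫ = ∑ᵢ ⟪T (eᵢ ⊗ x), eᵢ ⊗ y⟫` for an orthonormal basis `(eᵢ)` of `H₁`. -/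
def partialTrace₁ (T : TC H H) : TC H₂ H₂ :=
  compress (orthIsometries_tmulL H₂ H (stdBasis H₁).orthonormal) T

variable (H₁ H₂) in
/-- The partial trace `Tr₂ : S₁(H, H) → S₁(H₁, H₁)`,
`⟪Tr₂[T] x, y⟫ = ∑ⱼ ⟪T (x ⊗ fⱼ), y ⊗ fⱼ⟫` for an orthonormal basis `(fⱼ)` of `H₂`. -/
def partialTrace₂ (T : TC H H) : TC H₁ H₁ :=
  compress (orthIsometries_tmulR H₁ H (stdBasis H₂).orthonormal) T

/-- `Tr₁[A ⊗ B] = Tr[A] B`. -/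
theorem partialTrace₁_tensor (A : TC H₁ H₁) (B : TC H₂ H₂) :
    partialTrace₁ H₁ H₂ (TC.tensor A B : TC H H) = TC.trace A • B := by
  apply TC.toCLM_injective
  obtain ⟨a, b, h⟩ := (TC.tensor A B : TC H H).exists_rep
  have h1 := (compress_rep (orthIsometries_tmulL H₂ H (stdBasis H₁).orthonormal) h).1.hasSum
  have h2 := (TC.hasSum_trace (stdBasis H₁) A).smul_const (TC.toCLM B)
  refine h1.unique ?_
  rw [map_smul]
  convert h2 using 2 with i
  ext x
  refine ext_inner_right ℝ fun y => ?_
  change ⟪ContinuousLinearMap.adjoint _ (opTensor (TC.toCLM A) (TC.toCLM B)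
    (tmul (stdBasis H₁ i) x : H)), y⟫_ℝ = _
  rw [ContinuousLinearMap.adjoint_inner_left, opTensor_tmul, tmulL_apply, inner_tmul]
  simp [inner_smul_left]

/-- `Tr₂[A ⊗ B] = A Tr[B]`. -/
theorem partialTrace₂_tensor (A : TC H₁ H₁) (B : TC H₂ H₂) :
    partialTrace₂ H₁ H₂ (TC.tensor A B : TC H H) = TC.trace B • A := by
  apply TC.toCLM_injective
  obtain ⟨a, b, h⟩ := (TC.tensor A B : TC H H).exists_rep
  have h1 := (compress_rep (orthIsometries_tmulR H₁ H (stdBasis H₂).orthonormal) h).1.hasSum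
  have h2 := (TC.hasSum_trace (stdBasis H₂) B).smul_const (TC.toCLM A)
  refine h1.unique ?_
  rw [map_smul]
  convert h2 using 2 with i
  ext x
  refine ext_inner_right ℝ fun y => ?_
  change ⟪ContinuousLinearMap.adjoint _ (opTensor (TC.toCLM A) (TC.toCLM B)
    (tmul x (stdBasis H₂ i) : H)), y⟫_ℝ = _
  rw [ContinuousLinearMap.adjoint_inner_left, opTensor_tmul, tmulR_apply, inner_tmul]
  simp [inner_smul_left, mul_comm]

end TraceClass

section HilbertSchmidt

theorem hasSum_inner_HS {E F ι : Type*} [NormedAddCommGroup E] [InnerProductSpace ℝ E]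
    [CompleteSpace E] [NormedAddCommGroup F] [InnerProductSpace ℝ F] [CompleteSpace F]
    (b : HilbertBasis ι ℝ E) (S T : HS E F) :
    HasSum (fun i => ⟪HS.toCLM S (b i), HS.toCLM T (b i)⟫_ℝ) ⟪S, T⟫_ℝ := by
  have h := ((HS.hasSum_norm_sq b (S + T)).sub (HS.hasSum_norm_sq b (S - T))).div_const 4
  have e1 : (‖S + T‖ ^ 2 - ‖S - T‖ ^ 2) / 4 = ⟪S, T⟫_ℝ := by
    rw [norm_add_sq_real, norm_sub_sq_real]
    ring
  have e2 (i : ι) : (‖HS.toCLM (S + T) (b i)‖ ^ 2 - ‖HS.toCLM (S - T) (b i)‖ ^ 2) / 4 =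
      ⟪HS.toCLM S (b i), HS.toCLM T (b i)⟫_ℝ := by
    simp only [map_add, map_sub, add_apply, sub_apply]
    rw [norm_add_sq_real, norm_sub_sq_real]
    ring
  simpa only [e1, e2] using h

/-- The product of two orthonormal bases is an orthonormal basis of `H₁ ⊗ H₂`. -/
def prodBasis {ι κ : Type*} (e : HilbertBasis ι ℝ H₁) (f : HilbertBasis κ ℝ H₂) :
    HilbertBasis (ι × κ) ℝ H :=
  HilbertBasis.mkOfOrthogonalEqBot (v := fun p : ι × κ => (tmul (e p.1) (f p.2) : H))
    (by
      classical
      rw [orthonormal_iff_ite]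
      rintro ⟨i, k⟩ ⟨j, l⟩
      rw [inner_tmul, orthonormal_iff_ite.1 e.orthonormal, orthonormal_iff_ite.1 f.orthonormal]
      by_cases h1 : i = j <;> by_cases h2 : k = l <;> simp [h1, h2])
    (by
      rw [Submodule.eq_bot_iff]
      intro z hz
      have hz' (i : ι) (k : κ) : ⟪(tmul (e i) (f k) : H), z⟫_ℝ = 0 :=
        (Submodule.mem_orthogonal _ _).1 hz _ (Submodule.subset_span ⟨(i, k), rfl⟩)
      have h1 (i : ι) : innerSL ℝ z ∘L (tmulL (e i) : H₂ →L[ℝ] H) = 0 :=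
        HS.clm_ext_basis f fun k => by simpa [real_inner_comm] using hz' i k
      have h2 (y : H₂) : innerSL ℝ z ∘L (tmulR y : H₁ →L[ℝ] H) = 0 :=
        HS.clm_ext_basis e fun i => by
          simpa using congrArg (fun T : H₂ →L[ℝ] ℝ => T y) (h1 i)
      have h3 : innerSL ℝ z = 0 := clm_ext_tmul (H₁ := H₁) (H₂ := H₂) fun x y => by
        simpa using congrArg (fun T : H₁ →L[ℝ] ℝ => T x) (h2 y)
      have h4 : ⟪z, z⟫_ℝ = 0 := by
        simpa using congrArg (fun T : H →L[ℝ] ℝ => T z) h3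
      exact inner_self_eq_zero.1 h4)

@[simp] theorem prodBasis_apply {ι κ : Type*} (e : HilbertBasis ι ℝ H₁) (f : HilbertBasis κ ℝ H₂)
    (p : ι × κ) : (prodBasis e f : HilbertBasis (ι × κ) ℝ H) p = tmul (e p.1) (f p.2) := by
  simp [prodBasis]

theorem opTensor_mem_hilbertSchmidt (A : HS H₁ H₁) (B : HS H₂ H₂) :
    (opTensor (HS.toCLM A) (HS.toCLM B) : H →L[ℝ] H) ∈ hilbertSchmidt H H := by
  rw [HS.mem_hilbertSchmidt_iff (prodBasis (stdBasis H₁) (stdBasis H₂))]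
  simp_rw [prodBasis_apply, opTensor_tmul, norm_tmul, mul_pow]
  exact A.summable_sq.mul_of_nonneg B.summable_sq (fun _ => sq_nonneg _) (fun _ => sq_nonneg _)

/-- The tensor product `A ⊗ B ∈ S₂(H, H)` of Hilbert-Schmidt operators. -/
def HS.tensor : HS H₁ H₁ →ₗ[ℝ] HS H₂ H₂ →ₗ[ℝ] HS H H :=
  LinearMap.mk₂ ℝ
    (fun A B => ⟨opTensor (HS.toCLM A) (HS.toCLM B), opTensor_mem_hilbertSchmidt A B⟩)
    (fun A A' B => HS.toCLM_injective (opTensor_unique fun x y => by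
      change (opTensor _ _ + opTensor _ _ : H →L[ℝ] H) (tmul x y) = _
      simp [opTensor_tmul]))
    (fun c A B => HS.toCLM_injective (opTensor_unique fun x y => by
      change (c • opTensor _ _ : H →L[ℝ] H) (tmul x y) = _
      simp [opTensor_tmul]))
    (fun A B B' => HS.toCLM_injective (opTensor_unique fun x y => by
      change (opTensor _ _ + opTensor _ _ : H →L[ℝ] H) (tmul x y) = _
      simp [opTensor_tmul]))
    (fun c A B => HS.toCLM_injective (opTensor_unique fun x y => by
      change (c • opTensor _ _ : H →L[ℝ] H) (tmul x y) = _
      simp [opTensor_tmul]))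

theorem HS.toCLM_tensor (A : HS H₁ H₁) (B : HS H₂ H₂) :
    HS.toCLM (HS.tensor A B : HS H H) = opTensor (HS.toCLM A) (HS.toCLM B) := rfl

theorem HS.inner_tensor (A A' : HS H₁ H₁) (B B' : HS H₂ H₂) :
    ⟪(HS.tensor A B : HS H H), HS.tensor A' B'⟫_ℝ = ⟪A, A'⟫_ℝ * ⟪B, B'⟫_ℝ := by
  have h := hasSum_inner_HS (prodBasis (stdBasis H₁) (stdBasis H₂))
    (HS.tensor A B : HS H H) (HS.tensor A' B')
  have e (p : basisIndex H₁ × basisIndex H₂) :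
      ⟪HS.toCLM (HS.tensor A B : HS H H) (prodBasis (stdBasis H₁) (stdBasis H₂) p),
        HS.toCLM (HS.tensor A' B' : HS H H) (prodBasis (stdBasis H₁) (stdBasis H₂) p)⟫_ℝ =
      ⟪HS.toCLM A (stdBasis H₁ p.1), HS.toCLM A' (stdBasis H₁ p.1)⟫_ℝ *
        ⟪HS.toCLM B (stdBasis H₂ p.2), HS.toCLM B' (stdBasis H₂ p.2)⟫_ℝ := by
    rw [HS.toCLM_tensor, HS.toCLM_tensor, prodBasis_apply, opTensor_tmul, opTensor_tmul,
      inner_tmul]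
  simp only [e] at h
  have h1 : HasSum (fun i => ⟪HS.toCLM A (stdBasis H₁ i), HS.toCLM A' (stdBasis H₁ i)⟫_ℝ *
      ⟪B, B'⟫_ℝ) ⟪(HS.tensor A B : HS H H), HS.tensor A' B'⟫_ℝ :=
    h.prod_fiberwise fun i => (hasSum_inner_HS (stdBasis H₂) B B').mul_left
      ⟪HS.toCLM A (stdBasis H₁ i), HS.toCLM A' (stdBasis H₁ i)⟫_ℝ
  exact h1.unique ((hasSum_inner_HS (stdBasis H₁) A A').mul_right ⟪B, B'⟫_ℝ)

theorem HS.norm_tensor (A : HS H₁ H₁) (B : HS H₂ H₂) :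
    ‖(HS.tensor A B : HS H H)‖ = ‖A‖ * ‖B‖ := by
  rw [← sq_eq_sq₀ (norm_nonneg _) (by positivity), mul_pow, ← real_inner_self_eq_norm_sq,
    HS.inner_tensor, real_inner_self_eq_norm_sq, real_inner_self_eq_norm_sq]

/-- `B ↦ A ⊗ B`. -/
def HS.tensorL (A : HS H₁ H₁) : HS H₂ H₂ →L[ℝ] HS H H :=
  (HS.tensor A : HS H₂ H₂ →ₗ[ℝ] HS H H).mkContinuous ‖A‖ fun B => (HS.norm_tensor A B).le

/-- `A ↦ A ⊗ B`. -/
def HS.tensorR (B : HS H₂ H₂) : HS H₁ H₁ →L[ℝ] HS H H :=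
  ((HS.tensor : HS H₁ H₁ →ₗ[ℝ] HS H₂ H₂ →ₗ[ℝ] HS H H).flip B).mkContinuous ‖B‖ fun A => by
    rw [mul_comm]; exact (HS.norm_tensor A B).le

/-- The partial product `P₁(C, A)`, characterized by
`⟪P₁(C, A), B⟫ = ⟪C, A ⊗ B⟫` for all `B ∈ S₂(H₂, H₂)`. -/
def partialProd₁ (C : HS H H) (A : HS H₁ H₁) : HS H₂ H₂ :=
  ContinuousLinearMap.adjoint (HS.tensorL A) C

/-- The partial product `P₂(C, B)`, characterized by
`⟪P₂(C, B), A⟫ = ⟪C, A ⊗ B⟫` for all `A ∈ S₂(H₁, H₁)`. -/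
def partialProd₂ (C : HS H H) (B : HS H₂ H₂) : HS H₁ H₁ :=
  ContinuousLinearMap.adjoint (HS.tensorR B) C

theorem inner_partialProd₁ (C : HS H H) (A : HS H₁ H₁) (B : HS H₂ H₂) :
    ⟪partialProd₁ C A, B⟫_ℝ = ⟪C, HS.tensor A B⟫_ℝ :=
  ContinuousLinearMap.adjoint_inner_left _ _ _

theorem inner_partialProd₂ (C : HS H H) (A : HS H₁ H₁) (B : HS H₂ H₂) :
    ⟪partialProd₂ C B, A⟫_ℝ = ⟪C, HS.tensor A B⟫_ℝ :=
  ContinuousLinearMap.adjoint_inner_left _ _ _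

/-- `P₁(A ⊗ B, C₁) = ⟪A, C₁⟫ B`. -/
theorem partialProd₁_tensor (A C₁ : HS H₁ H₁) (B : HS H₂ H₂) :
    partialProd₁ (HS.tensor A B : HS H H) C₁ = ⟪A, C₁⟫_ℝ • B := by
  refine ext_inner_right ℝ fun B' => ?_
  rw [inner_partialProd₁, HS.inner_tensor, real_inner_smul_left]

/-- `P₂(A ⊗ B, C₂) = ⟪B, C₂⟫ A`. -/
theorem partialProd₂_tensor (A : HS H₁ H₁) (B C₂ : HS H₂ H₂) :
    partialProd₂ (HS.tensor A B : HS H H) C₂ = ⟪B, C₂⟫_ℝ • A := by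
  refine ext_inner_right ℝ fun A' => ?_
  rw [inner_partialProd₂, HS.inner_tensor, real_inner_smul_left, mul_comm]

variable (H₁ H₂) in
/-- The linear map `A ↦ P₁(C, A)`. -/
def partialProdLM (C : HS H H) : HS H₁ H₁ →ₗ[ℝ] HS H₂ H₂ where
  toFun A := partialProd₁ C A
  map_add' A A' := by
    refine ext_inner_right ℝ fun B => ?_
    rw [inner_add_left, inner_partialProd₁, inner_partialProd₁, inner_partialProd₁, map_add,
      LinearMap.add_apply, inner_add_right]
  map_smul' c A := by
    refine ext_inner_right ℝ fun B => ?_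
    rw [RingHom.id_apply, real_inner_smul_left, inner_partialProd₁, inner_partialProd₁,
      map_smul, LinearMap.smul_apply, real_inner_smul_right]

theorem norm_partialProd₁_le (C : HS H H) (A : HS H₁ H₁) :
    ‖(partialProd₁ C A : HS H₂ H₂)‖ ≤ ‖C‖ * ‖A‖ := by
  refine (ContinuousLinearMap.le_opNorm _ _).trans ?_
  rw [LinearIsometryEquiv.norm_map, mul_comm]
  gcongr
  exact LinearMap.mkContinuous_norm_le _ (norm_nonneg _) _

variable (H₁ H₂) in
/-- The restacked operator `Π[C]`. The spaces `H₁ ⊗ H₁` and `H₂ ⊗ H₂` are realized as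
`S₂(H₁, H₁)` and `S₂(H₂, H₂)`; then `Π[C] : S₂(H₁, H₁) → S₂(H₂, H₂)` is determined by linearity,
continuity in `C` and `Π[A ⊗ B] = ⟪A, ·⟫ B`. -/
def restack (C : HS H H) : HS H₁ H₁ →L[ℝ] HS H₂ H₂ :=
  (partialProdLM H₁ H₂ C).mkContinuous ‖C‖ (norm_partialProd₁_le C)

theorem restack_apply (C : HS H H) (A : HS H₁ H₁) : restack H₁ H₂ C A = partialProd₁ C A := rfl

theorem inner_restack (C : HS H H) (A : HS H₁ H₁) (B : HS H₂ H₂) :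
    ⟪restack H₁ H₂ C A, B⟫_ℝ = ⟪C, HS.tensor A B⟫_ℝ :=
  inner_partialProd₁ C A B

/-- `Π[A ⊗ B]` is the rank-one operator `⟪A, ·⟫ B`. -/
theorem restack_tensor (A E : HS H₁ H₁) (B : HS H₂ H₂) :
    restack H₁ H₂ (HS.tensor A B : HS H H) E = ⟪A, E⟫_ℝ • B := by
  rw [restack_apply, partialProd₁_tensor]

end HilbertSchmidt

end TensorClasses

section SingularTriples

variable {E F : Type*} [NormedAddCommGroup E] [InnerProductSpace ℝ E] [CompleteSpace E]
  [NormedAddCommGroup F] [InnerProductSpace ℝ F] [CompleteSpace F]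

/-- `γ` is a singular value of `S` with (normalized) singular vectors `e`, `f`. -/
def IsSingularTriple (S : E →L[ℝ] F) (γ : ℝ) (e : E) (f : F) : Prop :=
  0 ≤ γ ∧ ‖e‖ = 1 ∧ ‖f‖ = 1 ∧ S e = γ • f ∧ ContinuousLinearMap.adjoint S f = γ • e

/-- `γ` is the largest singular value of `S`, with corresponding singular vectors `e`, `f`. -/
def IsTopSingularTriple (S : E →L[ℝ] F) (γ : ℝ) (e : E) (f : F) : Prop :=
  IsSingularTriple S γ e f ∧ ∀ γ' e' f', IsSingularTriple S γ' e' f' → γ' ≤ γ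

end SingularTriples

section Approximations

variable (H₁ H₂ : Type*) {H : Type*} [NormedAddCommGroup H₁] [InnerProductSpace ℝ H₁]
  [CompleteSpace H₁] [NormedAddCommGroup H₂] [InnerProductSpace ℝ H₂] [CompleteSpace H₂]
  [NormedAddCommGroup H] [InnerProductSpace ℝ H] [CompleteSpace H] [HilbertTensor H₁ H₂ H]

/-- The partial-trace approximation `L^tr = (Tr₂[L] / Tr[L]) ⊗ Tr₁[L]`
(meaningful when `Tr[L] ≠ 0`). -/
def trApprox (L : TC H H) : TC H H :=
  TC.tensor ((TC.trace L)⁻¹ • partialTrace₂ H₁ H₂ L) (partialTrace₁ H₁ H₂ L)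

/-- The derivative at `C` of `L ↦ L - L^tr` in the direction `h`. -/
def trDeriv (C h : TC H H) : TC H H :=
  h - (TC.tensor ((TC.trace C)⁻¹ • partialTrace₂ H₁ H₂ h -
          (TC.trace h / TC.trace C ^ 2) • partialTrace₂ H₁ H₂ C) (partialTrace₁ H₁ H₂ C) +
        TC.tensor ((TC.trace C)⁻¹ • partialTrace₂ H₁ H₂ C) (partialTrace₁ H₁ H₂ h))

variable {H₂} in
/-- The partial-product approximation
`L^prod = P₂(L, Δ) ⊗ P₁(L, P₂(L, Δ)) / ‖P₂(L, Δ)‖₂²` (meaningful when `P₂(L, Δ) ≠ 0`). -/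
def prodApprox (Δ : HS H₂ H₂) (L : HS H H) : HS H H :=
  let p : HS H₁ H₁ := partialProd₂ L Δ
  let q : HS H₂ H₂ := partialProd₁ L p
  (‖p‖ ^ 2)⁻¹ • HS.tensor p q

variable {H₂} in
/-- The derivative at `C` of `L ↦ L - L^prod` in the direction `h`. -/
def prodDeriv (Δ : HS H₂ H₂) (C h : HS H H) : HS H H :=
  let p : HS H₁ H₁ := partialProd₂ C Δ
  let q : HS H₂ H₂ := partialProd₁ C p
  let dp : HS H₁ H₁ := partialProd₂ h Δ
  let dq : HS H₂ H₂ := partialProd₁ C dp + partialProd₁ h p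
  h - ((‖p‖ ^ 2)⁻¹ • (HS.tensor dp q + HS.tensor p dq) -
    (2 * ⟪dp, p⟫_ℝ / ‖p‖ ^ 4) • HS.tensor p q)

/-- `T` is an optimal separable approximation of `L`: a minimizer of `‖L - A ⊗ B‖₂²`
over `A ∈ S₂(H₁, H₁)` and `B ∈ S₂(H₂, H₂)`. -/
def IsOptimalSeparable (L T : HS H H) : Prop :=
  (∃ (A : HS H₁ H₁) (B : HS H₂ H₂), T = HS.tensor A B) ∧
    ∀ (A : HS H₁ H₁) (B : HS H₂ H₂), ‖L - T‖ ^ 2 ≤ ‖L - HS.tensor A B‖ ^ 2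

open Classical in
/-- The approximation `L^opt = Π⁻¹[γ₁ e₁ ⊗ f₁] = γ₁ e₁ ⊗ f₁`, where `γ₁` is the largest singular
value of `Π[L]` and `e₁ ∈ S₂(H₁, H₁)`, `f₁ ∈ S₂(H₂, H₂)` are corresponding singular vectors.
If there are several choices, one is fixed arbitrarily. (If there is none, then `S₂(H₁, H₁)`
or `S₂(H₂, H₂)` is trivial, and the value is `0`.) -/
def optApprox (L : HS H H) : HS H H :=
  if h : ∃ p : ℝ × HS H₁ H₁ × HS H₂ H₂,
      IsTopSingularTriple (restack H₁ H₂ L) p.1 p.2.1 p.2.2 then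
    h.choose.1 • HS.tensor h.choose.2.1 h.choose.2.2
  else 0

variable {H₁ H₂} in
/-- The derivative at `C` of `L ↦ L - L^opt` in the direction `h`, expressed through the largest
singular value `γ` of `A = Π[C]`, an orthonormal basis `e` of eigenvectors of `A* A` with
eigenvalues `α`, and an orthonormal basis `f` of eigenvectors of `A A*` with eigenvalues `β`;
`e i₁` and `f k₁` are the singular vectors corresponding to `γ`. With `K = Π[h]`,
`⟪K e₁, f₁⟫`, `u` and `v` are the directional derivatives of `γ`, `e₁` and `f₁`. -/
def optDeriv {ι κ : Type*} (C : HS H H) (γ : ℝ) (e : ι → HS H₁ H₁) (f : κ → HS H₂ H₂)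
    (i₁ : ι) (k₁ : κ) (α : ι → ℝ) (β : κ → ℝ) (h : HS H H) : HS H H :=
  let A := restack H₁ H₂ C
  let A' := ContinuousLinearMap.adjoint A
  let K := restack H₁ H₂ h
  let K' := ContinuousLinearMap.adjoint K
  let u : HS H₁ H₁ := ∑' i : {i // i ≠ i₁},
    (⟪A' (K (e i₁)) + K' (A (e i₁)), e i⟫_ℝ / (γ ^ 2 - α i)) • e i
  let v : HS H₂ H₂ := ∑' k : {k // k ≠ k₁},
    (⟪A (K' (f k₁)) + K (A' (f k₁)), f k⟫_ℝ / (γ ^ 2 - β k)) • f k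
  h - (⟪K (e i₁), f k₁⟫_ℝ • HS.tensor (e i₁) (f k₁) +
    γ • (HS.tensor u (f k₁) + HS.tensor (e i₁) v))

end Approximations

section Sequential

variable {S : Type*} [NormedAddCommGroup S] [NormedSpace ℝ S]

/-- The function `t ↦ t C` in `C([a, b], S)`. -/
def ray (a b : ℝ) (C : S) : C(Set.Icc a b, S) := ⟨fun t => (t : ℝ) • C, by fun_prop⟩

open Classical in
/-- For a map `Φ` (sending an operator to its approximation), the map `L(·) ↦ L(·) - Φ(L(·))` on
`C([a, b], S)`. It is set to `0` where `t ↦ Φ(L(t))` is not continuous. -/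
def seqResidual {a b : ℝ} (Φ : S → S) (L : C(Set.Icc a b, S)) : C(Set.Icc a b, S) :=
  if h : Continuous fun t => Φ (L t) then L - ⟨fun t => Φ (L t), h⟩ else 0

end Sequential

section SpaceTime

variable {X Y : Type*} [MeasurableSpace X] [MeasurableSpace Y]

/-- The real Hilbert space `L²(μ)`. -/
abbrev L2 (μ : Measure X) : Type _ := ↥(Lp ℝ 2 μ)

theorem memLp_mul {μ : Measure X} {ν : Measure Y} [IsFiniteMeasure μ] [IsFiniteMeasure ν]
    (f : Lp ℝ 2 μ) (g : Lp ℝ 2 ν) :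
    MemLp (fun p : X × Y => f p.1 * g p.2) 2 (μ.prod ν) := by
  have hf := Lp.memLp f
  have hg := Lp.memLp g
  refine (memLp_two_iff_integrable_sq (hf.1.comp_fst.mul hg.1.comp_snd)).2 ?_
  simpa [mul_pow] using hf.integrable_sq.mul_prod hg.integrable_sq

/-- `L²(μ ⊗ ν)` is the tensor product Hilbert space of `L²(μ)` and `L²(ν)`, with
`(f ⊗ g)(s, t) = f(s) g(t)`. -/
instance (μ : Measure X) (ν : Measure Y) [IsFiniteMeasure μ] [IsFiniteMeasure ν] :
    HilbertTensor (L2 μ) (L2 ν) (L2 (μ.prod ν)) where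
  tmul := LinearMap.mk₂ ℝ (fun f g => (memLp_mul f g).toLp _)
    (fun f f' g => by
      rw [← MemLp.toLp_add]
      refine MemLp.toLp_congr _ _ ?_
      filter_upwards [Measure.quasiMeasurePreserving_fst.ae_eq_comp (Lp.coeFn_add f f')] with p hp
      simp only [Function.comp_apply] at hp
      simp only [hp, Pi.add_apply, add_mul])
    (fun c f g => by
      rw [← MemLp.toLp_const_smul]
      refine MemLp.toLp_congr _ _ ?_
      filter_upwards [Measure.quasiMeasurePreserving_fst.ae_eq_comp (Lp.coeFn_smul c f)] with p hp
      simp only [Function.comp_apply] at hp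
      simp [hp, mul_assoc])
    (fun f g g' => by
      rw [← MemLp.toLp_add]
      refine MemLp.toLp_congr _ _ ?_
      filter_upwards [Measure.quasiMeasurePreserving_snd.ae_eq_comp (Lp.coeFn_add g g')] with p hp
      simp only [Function.comp_apply] at hp
      simp only [hp, Pi.add_apply, mul_add])
    (fun c f g => by
      rw [← MemLp.toLp_const_smul]
      refine MemLp.toLp_congr _ _ ?_
      filter_upwards [Measure.quasiMeasurePreserving_snd.ae_eq_comp (Lp.coeFn_smul c g)] with p hp
      simp only [Function.comp_apply] at hp
      simp [hp, mul_left_comm])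
  inner_tmul f g f' g' := by
    rw [L2.inner_def, L2.inner_def, L2.inner_def, ← integral_prod_mul]
    refine integral_congr_ae ?_
    filter_upwards [(memLp_mul f g).coeFn_toLp, (memLp_mul f' g').coeFn_toLp] with p hp hp'
    simp only [LinearMap.mk₂_apply]
    rw [hp, hp']
    simp only [RCLike.inner_apply, conj_trivial]
    ring
  dense_tmul := by
    rw [Submodule.dense_iff_topologicalClosure_eq_top, Submodule.topologicalClosure_eq_top_iff,
      Submodule.eq_bot_iff]
    intro z hz
    have h0 (s : Set X) (t : Set Y) (hs : MeasurableSet s) (ht : MeasurableSet t) :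
        ∫ p in s ×ˢ t, z p ∂(μ.prod ν) = 0 := by
      have h1 := (Submodule.mem_orthogonal _ _).1 hz _ (Submodule.subset_span
        ⟨(indicatorConstLp 2 hs (measure_ne_top μ s) (1 : ℝ),
          indicatorConstLp 2 ht (measure_ne_top ν t) (1 : ℝ)), rfl⟩)
      rw [← integral_indicator (hs.prod ht), ← h1, L2.inner_def]
      refine integral_congr_ae ?_
      filter_upwards [(memLp_mul (indicatorConstLp 2 hs (measure_ne_top μ s) (1 : ℝ))
          (indicatorConstLp 2 ht (measure_ne_top ν t) (1 : ℝ))).coeFn_toLp,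
        Measure.quasiMeasurePreserving_fst.ae_eq_comp
          (indicatorConstLp_coeFn (p := 2) (hs := hs) (hμs := measure_ne_top μ s) (c := (1 : ℝ))),
        Measure.quasiMeasurePreserving_snd.ae_eq_comp
          (indicatorConstLp_coeFn (p := 2) (hs := ht) (hμs := measure_ne_top ν t) (c := (1 : ℝ)))]
        with p hp hp1 hp2
      simp only [Function.comp_apply] at hp1 hp2
      simp only [LinearMap.mk₂_apply]
      rw [hp, hp1, hp2]
      by_cases h1 : p.1 ∈ s <;> by_cases h2 : p.2 ∈ t <;> simp [Set.indicator, h1, h2]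
    have hint : Integrable z (μ.prod ν) := (Lp.memLp z).integrable (by norm_num)
    have hall : ∀ s, MeasurableSet s → ∫ p in s, z p ∂(μ.prod ν) = 0 := by
      intro s hs
      induction s, hs using MeasurableSpace.induction_on_inter generateFrom_prod.symm
        isPiSystem_prod with
      | empty => simp
      | basic s h =>
        obtain ⟨u, hu, v, hv, rfl⟩ := h
        exact h0 u v hu hv
      | compl s hs ih =>
        have := integral_add_compl hs hint
        have h2 := h0 Set.univ Set.univ MeasurableSet.univ MeasurableSet.univ
        rw [Set.univ_prod_univ, Measure.restrict_univ] at h2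
        linarith
      | iUnion f hd hf ih =>
        rw [integral_iUnion hf hd hint.integrableOn]
        simp [ih]
    have hz0 := hint.ae_eq_zero_of_forall_setIntegral_eq_zero fun s hs _ => hall s hs
    exact (Lp.eq_zero_iff_ae_eq_zero).2 hz0

end SpaceTime

end SepApprox

end

open SepApprox

/-! All three approximations are positively homogeneous of degree one on an open cone `U` containing
`C`. Hence the remainder of the pointwise map at time `t` is `t` times the remainder of `Φ` at `C`
evaluated at `t⁻¹ L(t)`. As `t ≥ a > 0`, the points `t⁻¹ L(t)` lie uniformly close to `C` when `L`
is close to the ray, so differentiability of `Φ` at the single point `C` gives differentiability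
along the whole ray (`hasFDerivAt_seqResidual`).

For partial traces and partial products, `Φ` is composed of bounded linear and bilinear maps and of
the inverse of a nonvanishing scalar; the work lies in the trace-norm bounds for traces, partial
traces and tensor products, after which the product rule gives the formulas.

For optimal approximations, `‖L - A ⊗ B‖² = ‖L‖² - 2⟪Π[L]A, B⟫ + ‖A‖²‖B‖²`, so the minimizers are
the tensors `x ⊗ Π[L]x` with `x` a unit vector at which the compact operator `Π[L]` attains its
norm. Uniqueness of the minimizer is equivalent to a spectral gap: `Π[L]` has norm smaller than
`‖Π[L]‖` on the orthogonal complement of such an `x`. A gap survives small perturbations, which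
gives openness (`IsTensorToOp.isOpen_uniqueBest`).

The gap also makes `γ₁² - A*A` invertible on the complement of `e₁`, where `A = Π[C]`. Writing the
perturbed leading eigenvector as `e₁ + x(L)` with `x(L) ⟂ e₁` and projecting the eigenvalue equation
off `e₁` gives `x(L) = w(L) + o(1)‖x(L)‖` with `w` explicit and differentiable, so `x` inherits the
derivative of `w` (`hasFDerivAt_eigenvector`). The projection removes the varying eigenvalue to
first order, so only its continuity is needed. Since `L^opt` equals `‖y‖⁻² y ⊗ Π[L]y` with `y = e₁ +
x(L)`, its derivative follows from the product rule, and expanding in the eigenbases gives the sums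
for `u` and `v` (`singular_vector_deriv_eq`). -/

namespace SepApprox

/-! ### Homogeneous maps acting pointwise on curves near a ray -/

section Superposition

variable {S : Type*} [NormedAddCommGroup S] [NormedSpace ℝ S]

/-- Near the ray through `C`, the curves stay in an open cone containing `C`. -/
theorem eventually_forall_mem_cone {a b : ℝ} (ha : 0 < a) {C : S} {U : Set S} (hU : IsOpen U)
    (hcone : ∀ x ∈ U, ∀ c : ℝ, 0 < c → c • x ∈ U) (hC : C ∈ U) :
    ∀ᶠ L in 𝓝 (ray a b C), ∀ t, L t ∈ U := by
  -- The interval is compact, so the curves with values in the open set `U` form an open set for the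
  -- maximum norm.
  have h := ContinuousMap.isOpen_setOfPred_mapsTo (X := Set.Icc a b) (isCompact_univ) hU
  filter_upwards [h.mem_nhds (x := ray a b C) fun t _ => hcone C hC _ (ha.trans_le t.2.1)] with L hL
  exact fun t => hL (Set.mem_univ t)

/-- Near the ray through `C`, a map that is continuous on an open cone containing `C` acts
pointwise on continuous curves. -/
theorem continuous_comp_of_forall_mem {a b : ℝ} {U : Set S} {Φ : S → S}
    (hΦ : ContinuousOn Φ U) {L : C(Set.Icc a b, S)} (hL : ∀ t, L t ∈ U) :
    Continuous fun t => Φ (L t) :=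
  hΦ.comp_continuous L.continuous hL

/-- The pointwise action of a positively homogeneous map on curves is Fréchet differentiable at
the ray through `C` if the map is Fréchet differentiable at `C`. -/
theorem hasFDerivAt_seqResidual {a b : ℝ} (ha : 0 < a) {C : S} {U : Set S} (hU : IsOpen U)
    (hcone : ∀ x ∈ U, ∀ c : ℝ, 0 < c → c • x ∈ U) (hC : C ∈ U) {Φ : S → S}
    (hcont : ContinuousOn Φ U) (hhom : ∀ x ∈ U, ∀ c : ℝ, 0 < c → Φ (c • x) = c • Φ x)
    {Φ' : S →L[ℝ] S} (hΦ : HasFDerivAt Φ Φ' C) :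
    HasFDerivAt (seqResidual (a := a) (b := b) Φ)
      ((ContinuousLinearMap.id ℝ S - Φ').compLeftContinuous ℝ (Set.Icc a b)) (ray a b C) := by
  have hev := eventually_forall_mem_cone (a := a) (b := b) ha hU hcone hC
  have hres {L : C(Set.Icc a b, S)} (hL : ∀ t, L t ∈ U) (t : Set.Icc a b) :
      seqResidual Φ L t = L t - Φ (L t) := by
    rw [seqResidual, dif_pos (continuous_comp_of_forall_mem hcont hL)]
    rfl
  rw [hasFDerivAt_iff_isLittleO, Asymptotics.isLittleO_iff]
  intro ε hε
  have h1 := (Asymptotics.isLittleO_iff.1 (hasFDerivAt_iff_isLittleO.1 hΦ)) hε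
  obtain ⟨δ, hδ, h2⟩ := Metric.eventually_nhds_iff.1 h1
  -- The radius `a δ` ensures `‖t⁻¹ L(t) - C‖ < δ` for every `t ≥ a` simultaneously.
  filter_upwards [hev, Metric.ball_mem_nhds (ray a b C) (mul_pos ha hδ)] with L hL hd
  rw [ContinuousMap.norm_le _ (by positivity)]
  intro t
  have ht : 0 < (t : ℝ) := ha.trans_le t.2.1
  have hray : ray a b C t = (t : ℝ) • C := rfl
  have hle : ‖L t - (t : ℝ) • C‖ ≤ ‖L - ray a b C‖ := (L - ray a b C).norm_coe_le_norm t
  have hsc : (t : ℝ)⁻¹ • L t - C = (t : ℝ)⁻¹ • (L t - (t : ℝ) • C) := by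
    rw [smul_sub, inv_smul_smul₀ ht.ne']
  have hnear : dist ((t : ℝ)⁻¹ • L t) C < δ := by
    rw [dist_eq_norm, hsc, norm_smul, norm_inv, Real.norm_of_nonneg ht.le, inv_mul_lt_iff₀ ht]
    rw [Metric.mem_ball, dist_eq_norm] at hd
    exact hle.trans_lt (hd.trans_le (by gcongr; exact t.2.1))
  have h3 := h2 hnear
  have hmem := hcone _ (hL t) _ (inv_pos.2 ht)
  -- Homogeneity turns the remainder at `t C` into `t` times the remainder of `Φ` at `C`; the
  -- identity parts cancel.
  have e : (seqResidual Φ L - seqResidual Φ (ray a b C) -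
      ((ContinuousLinearMap.id ℝ S - Φ').compLeftContinuous ℝ (Set.Icc a b)) (L - ray a b C)) t =
      -((t : ℝ) • (Φ ((t : ℝ)⁻¹ • L t) - Φ C - Φ' ((t : ℝ)⁻¹ • L t - C))) := by
    rw [ContinuousMap.sub_apply, ContinuousMap.sub_apply, hres hL, hres hev.self_of_nhds, hray,
      hhom C hC _ ht, smul_sub, smul_sub, hsc, map_smul, smul_inv_smul₀ ht.ne', ← hhom _ hmem _ ht,
      smul_inv_smul₀ ht.ne']
    change _ - ((L t - ray a b C t) - Φ' (L t - ray a b C t)) = _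
    rw [hray]
    abel
  rw [e, norm_neg, norm_smul, Real.norm_of_nonneg ht.le]
  calc _ ≤ (t : ℝ) * (ε * ‖(t : ℝ)⁻¹ • L t - C‖) := by gcongr
    _ = ε * ‖L t - (t : ℝ) • C‖ := by
      rw [hsc, norm_smul, norm_inv, Real.norm_of_nonneg ht.le]
      field_simp
    _ ≤ _ := by gcongr

end Superposition

/-! ### Trace-norm bounds and the partial-trace approximation -/

section TraceClassMaps

/-- Passes a bound valid for every nuclear representation to the infimum defining `‖T‖₁`. The case
`s = 0` is separate because the argument divides by `s`. -/
theorem TC.le_norm_mul {E F : Type*} [NormedAddCommGroup E] [InnerProductSpace ℝ E]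
    [NormedAddCommGroup F] [InnerProductSpace ℝ F] {T : TC E F} {x s : ℝ} (hs : 0 ≤ s)
    (h : ∀ r ∈ repSums T, x ≤ r * s) : x ≤ ‖T‖ * s := by
  rcases hs.eq_or_lt with rfl | hs
  · obtain ⟨r, hr⟩ := repSums_nonempty T
    simpa using h r hr
  · rw [← div_le_iff₀ hs]
    exact le_csInf (repSums_nonempty T) fun r hr => (div_le_iff₀ hs).2 (h r hr)

theorem TC.nonneg_of_mem_repSums {E F : Type*} [NormedAddCommGroup E] [InnerProductSpace ℝ E]
    [NormedAddCommGroup F] [InnerProductSpace ℝ F] {T : TC E F} {r : ℝ} (h : r ∈ repSums T) :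
    0 ≤ r :=
  (norm_nonneg _).trans (norm_toCLM_le_of_mem h)

section Trace

variable {E : Type*} [NormedAddCommGroup E] [InnerProductSpace ℝ E] [CompleteSpace E]

/-- In any representation the trace is `∑ ⟪aₙ, bₙ⟫`, to which Cauchy-Schwarz applies term by term.
-/
theorem TC.abs_trace_le (T : TC E E) : |trace T| ≤ ‖T‖ := by
  refine le_csInf (repSums_nonempty T) ?_
  rintro r ⟨a, b, h, rfl⟩
  rw [trace_eq_of_rep T h, ← Real.norm_eq_abs]
  exact tsum_of_norm_bounded h.1.hasSum fun n => norm_inner_le_norm _ _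

/-- The trace as a continuous linear functional on the trace-class operators. -/
noncomputable def TC.traceL : TC E E →L[ℝ] ℝ :=
  LinearMap.mkContinuous
    { toFun := trace
      map_add' := fun S T => by
        refine (hasSum_trace (stdBasis E) (S + T)).unique ?_
        simpa [inner_add_left] using
          (hasSum_trace (stdBasis E) S).add (hasSum_trace (stdBasis E) T)
      map_smul' := fun c T => by
        refine (hasSum_trace (stdBasis E) (c • T)).unique ?_
        simpa [inner_smul_left] using (hasSum_trace (stdBasis E) T).mul_left c } 1
    fun T => by simpa using abs_trace_le T

@[simp] theorem TC.traceL_apply (T : TC E E) : traceL T = trace T := rfl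

end Trace

section Compress

variable {K H ι : Type*} [NormedAddCommGroup K] [InnerProductSpace ℝ K] [CompleteSpace K]
  [NormedAddCommGroup H] [InnerProductSpace ℝ H] [CompleteSpace H]

open ContinuousLinearMap in
-- A representation of `T` induces one of the compression with vectors `Jᵢ* aₙ`, `Jᵢ* bₙ`. For each
-- `n`, Cauchy-Schwarz over `i` and Bessel's inequality for the orthogonal ranges bound its
-- contribution by `‖aₙ‖ ‖bₙ‖`.
theorem norm_compress_le {J : ι → K →L[ℝ] H} (hJ : OrthIsometries J) (T : TC H H) :
    ‖compress hJ T‖ ≤ ‖T‖ := by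
  refine le_csInf (TC.repSums_nonempty T) ?_
  rintro r ⟨a, b, h, rfl⟩
  have hrep := (compress_rep hJ h).2
  refine (TC.traceNorm_le_of_rep (T := compress hJ T) hrep).trans ?_
  rw [hrep.1.tsum_prod]
  have hle (n : ℕ) (s : Finset ι) :
      ∑ i ∈ s, ‖adjoint (J i) (a n)‖ * ‖adjoint (J i) (b n)‖ ≤ ‖a n‖ * ‖b n‖ := by
    refine (Real.sum_mul_le_sqrt_mul_sqrt s _ _).trans ?_
    gcongr
    · exact (Real.sqrt_le_left (norm_nonneg _)).2 (hJ.bessel s _)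
    · exact (Real.sqrt_le_left (norm_nonneg _)).2 (hJ.bessel s _)
  exact hrep.1.prod.tsum_le_tsum (fun n => (hrep.1.prod_factor n).tsum_le_of_sum_le (hle n)) h.1

/-- The compression `T ↦ ∑ᵢ Jᵢ* T Jᵢ` as a continuous linear map of trace-class operators. -/
noncomputable def compressL {J : ι → K →L[ℝ] H} (hJ : OrthIsometries J) : TC H H →L[ℝ] TC K K :=
  LinearMap.mkContinuous
    { toFun := compress hJ
      map_add' := fun S T => by
        apply TC.toCLM_injective
        obtain ⟨a, b, h⟩ := S.exists_rep
        obtain ⟨c, d, h'⟩ := T.exists_rep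
        have h1 := (compress_rep hJ h).1.tsum_add (compress_rep hJ h').1
        rw [map_add]
        refine Eq.trans ?_ h1
        change compressCLM J _ = _
        rw [compressCLM]
        congr 1 with i x
        simp
      map_smul' := fun c T => by
        apply TC.toCLM_injective
        obtain ⟨a, b, h⟩ := T.exists_rep
        have h1 := (compress_rep hJ h).1.tsum_const_smul c
        rw [map_smul]
        refine Eq.trans ?_ h1
        change compressCLM J _ = _
        rw [compressCLM]
        congr 1 with i x
        simp } 1
    fun T => by simpa using norm_compress_le hJ T

@[simp] theorem compressL_apply {J : ι → K →L[ℝ] H} (hJ : OrthIsometries J) (T : TC H H) :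
    compressL hJ T = compress hJ T := rfl

end Compress

variable {H₁ H₂ H : Type*} [NormedAddCommGroup H₁] [InnerProductSpace ℝ H₁] [CompleteSpace H₁]
  [NormedAddCommGroup H₂] [InnerProductSpace ℝ H₂] [CompleteSpace H₂]
  [NormedAddCommGroup H] [InnerProductSpace ℝ H] [CompleteSpace H] [HilbertTensor H₁ H₂ H]

open HilbertTensor

/-- Tensoring representations of `A` and `B` represents `A ⊗ B`, and its sum factors as the product
of the two sums; then take the infimum over each factor in turn. -/
theorem TC.norm_tensor_le (A : TC H₁ H₁) (B : TC H₂ H₂) :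
    ‖(TC.tensor A B : TC H H)‖ ≤ ‖A‖ * ‖B‖ := by
  refine TC.le_norm_mul (norm_nonneg _) fun r hr => ?_
  rw [mul_comm]
  refine TC.le_norm_mul (TC.nonneg_of_mem_repSums hr) fun s hs => ?_
  obtain ⟨a, b, h, rfl⟩ := hr
  obtain ⟨c, d, h', rfl⟩ := hs
  have hrep := opTensor_rep (H := H) h h'
  refine (TC.traceNorm_le_of_rep (T := (TC.tensor A B : TC H H)) hrep).trans_eq ?_
  simp_rw [norm_tmul, mul_mul_mul_comm]
  rw [mul_comm, h.1.tsum_mul_tsum h'.1]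
  exact h.1.mul_of_nonneg h'.1 (fun _ => by positivity) (fun _ => by positivity)

theorem TC.tensor_unique {A : TC H₁ H₁} {B : TC H₂ H₂} {T : TC H H}
    (h : ∀ x y, toCLM T (tmul x y) = tmul (toCLM A x) (toCLM B y)) : TC.tensor A B = T :=
  TC.toCLM_injective (opTensor_unique h)

theorem TC.toCLM_tensor_tmul (A : TC H₁ H₁) (B : TC H₂ H₂) (x : H₁) (y : H₂) :
    toCLM (TC.tensor A B : TC H H) (tmul x y) = tmul (toCLM A x) (toCLM B y) :=
  opTensor_tmul _ _ x y

variable (H₁ H₂ H) in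
/-- The tensor product of trace-class operators as a bounded bilinear map. -/
noncomputable def TC.tensorB : TC H₁ H₁ →L[ℝ] TC H₂ H₂ →L[ℝ] TC H H :=
  LinearMap.mkContinuous₂
    (LinearMap.mk₂ ℝ TC.tensor
      (fun A A' B => TC.tensor_unique fun x y => by simp [TC.toCLM_tensor_tmul])
      (fun c A B => TC.tensor_unique fun x y => by simp [TC.toCLM_tensor_tmul])
      (fun A B B' => TC.tensor_unique fun x y => by simp [TC.toCLM_tensor_tmul])
      (fun c A B => TC.tensor_unique fun x y => by simp [TC.toCLM_tensor_tmul])) 1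
    fun A B => by simpa using TC.norm_tensor_le A B

@[simp] theorem TC.tensorB_apply (A : TC H₁ H₁) (B : TC H₂ H₂) :
    TC.tensorB H₁ H₂ H A B = TC.tensor A B := rfl

variable (H₁ H₂ H) in
/-- The partial trace `Tr₁` as a continuous linear map. -/
noncomputable def partialTraceL₁ : TC H H →L[ℝ] TC H₂ H₂ :=
  compressL (orthIsometries_tmulL H₂ H (stdBasis H₁).orthonormal)

variable (H₁ H₂ H) in
/-- The partial trace `Tr₂` as a continuous linear map. -/
noncomputable def partialTraceL₂ : TC H H →L[ℝ] TC H₁ H₁ :=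
  compressL (orthIsometries_tmulR H₁ H (stdBasis H₂).orthonormal)

@[simp] theorem partialTraceL₁_apply (T : TC H H) :
    partialTraceL₁ H₁ H₂ H T = partialTrace₁ H₁ H₂ T := rfl

@[simp] theorem partialTraceL₂_apply (T : TC H H) :
    partialTraceL₂ H₁ H₂ H T = partialTrace₂ H₁ H₂ T := rfl

/-- Exhibits the approximation through bounded linear and bilinear maps, the form needed for
continuity and the product rule. -/
theorem trApprox_eq (L : TC H H) : trApprox H₁ H₂ L =
    TC.tensorB H₁ H₂ H ((TC.traceL L)⁻¹ • partialTraceL₂ H₁ H₂ H L) (partialTraceL₁ H₁ H₂ H L) :=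
  rfl

theorem trApprox_smul (L : TC H H) (c : ℝ) (hc : c ≠ 0) :
    trApprox H₁ H₂ (c • L) = c • trApprox H₁ H₂ L := by
  simp only [trApprox_eq, map_smul, smul_eq_mul, mul_inv, smul_smul, smul_apply]
  congr 1
  field_simp

theorem isOpen_trace_ne_zero : IsOpen {L : TC H H | TC.trace L ≠ 0} :=
  isOpen_ne_fun TC.traceL.continuous continuous_const

theorem continuousOn_trApprox :
    ContinuousOn (trApprox H₁ H₂ : TC H H → TC H H) {L | TC.trace L ≠ 0} := by
  change ContinuousOn (fun L => TC.tensorB H₁ H₂ H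
    ((TC.traceL L)⁻¹ • partialTraceL₂ H₁ H₂ H L) (partialTraceL₁ H₁ H₂ H L)) _
  have h : ContinuousOn (fun L : TC H H => (TC.traceL L)⁻¹) {L | TC.trace L ≠ 0} :=
    TC.traceL.continuous.continuousOn.inv₀ fun L hL => hL
  fun_prop

/-- Product rule for the bilinear tensor map: the first factor contributes the derivative of `Tr₂[L]
/ Tr[L]`, the second the linear map `Tr₁`. -/
theorem exists_hasFDerivAt_trApprox {C : TC H H} (hC : TC.trace C ≠ 0) :
    ∃ Φ' : TC H H →L[ℝ] TC H H, HasFDerivAt (trApprox H₁ H₂) Φ' C ∧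
      ∀ h, h - Φ' h = trDeriv H₁ H₂ C h := by
  have h0 : HasFDerivAt (fun L : TC H H => (TC.traceL L)⁻¹) _ C :=
    (hasDerivAt_inv (x := TC.traceL C) hC).comp_hasFDerivAt C TC.traceL.hasFDerivAt
  have h1 := h0.smul (partialTraceL₂ H₁ H₂ H).hasFDerivAt
  have h2 := (TC.tensorB H₁ H₂ H).hasFDerivAt_of_bilinear h1
    (partialTraceL₁ H₁ H₂ H).hasFDerivAt
  refine ⟨_, h2, fun h => ?_⟩
  rw [trDeriv]
  congr 1
  simp only [← TC.tensorB_apply, ← partialTraceL₁_apply, ← partialTraceL₂_apply, ← TC.traceL_apply]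
  simp [ContinuousLinearMap.precompR, ContinuousLinearMap.precompL]
  rw [div_eq_inv_mul]
  abel

end TraceClassMaps

/-! ### The partial-product approximation -/

section PartialProducts

variable {H₁ H₂ H : Type*} [NormedAddCommGroup H₁] [InnerProductSpace ℝ H₁] [CompleteSpace H₁]
  [NormedAddCommGroup H₂] [InnerProductSpace ℝ H₂] [CompleteSpace H₂]
  [NormedAddCommGroup H] [InnerProductSpace ℝ H] [CompleteSpace H] [HilbertTensor H₁ H₂ H]

variable (H₁ H₂ H) in
/-- The tensor product of Hilbert-Schmidt operators as a bounded bilinear map. -/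
noncomputable def HS.tensorB : HS H₁ H₁ →L[ℝ] HS H₂ H₂ →L[ℝ] HS H H :=
  LinearMap.mkContinuous₂ HS.tensor 1 fun A B => by simpa using (HS.norm_tensor A B).le

@[simp] theorem HS.tensorB_apply (A : HS H₁ H₁) (B : HS H₂ H₂) :
    HS.tensorB H₁ H₂ H A B = HS.tensor A B := rfl

theorem restack_add (C C' : HS H H) :
    restack H₁ H₂ (C + C') = restack H₁ H₂ C + restack H₁ H₂ C' := by
  ext1 A
  refine ext_inner_right ℝ fun B => ?_
  rw [add_apply, inner_add_left, inner_restack, inner_restack, inner_restack, inner_add_left]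

theorem restack_smul (c : ℝ) (C : HS H H) :
    restack H₁ H₂ (c • C) = c • restack H₁ H₂ C := by
  ext1 A
  refine ext_inner_right ℝ fun B => ?_
  rw [smul_apply, real_inner_smul_left, inner_restack, inner_restack, real_inner_smul_left]

variable (H₁ H₂ H) in
/-- The restacking map `C ↦ Π[C]` as a bounded linear map. -/
noncomputable def restackL : HS H H →L[ℝ] HS H₁ H₁ →L[ℝ] HS H₂ H₂ :=
  LinearMap.mkContinuous
    { toFun := restack H₁ H₂
      map_add' := restack_add
      map_smul' := restack_smul } 1
    fun C => by
      rw [one_mul]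
      exact LinearMap.mkContinuous_norm_le _ (norm_nonneg _) (norm_partialProd₁_le C)

@[simp] theorem restackL_apply (C : HS H H) : restackL H₁ H₂ H C = restack H₁ H₂ C := rfl

/-- The map `C ↦ P₂(C, Δ)` as a bounded linear map. -/
noncomputable def partialProdL₂ (Δ : HS H₂ H₂) : HS H H →L[ℝ] HS H₁ H₁ :=
  ContinuousLinearMap.adjoint (HS.tensorR Δ)

@[simp] theorem partialProdL₂_apply (Δ : HS H₂ H₂) (C : HS H H) :
    partialProdL₂ (H₁ := H₁) Δ C = partialProd₂ C Δ := rfl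

theorem prodApprox_eq (Δ : HS H₂ H₂) (L : HS H H) : prodApprox H₁ Δ L =
    (‖partialProdL₂ (H₁ := H₁) Δ L‖ ^ 2)⁻¹ • HS.tensorB H₁ H₂ H (partialProdL₂ Δ L)
      (restackL H₁ H₂ H L (partialProdL₂ Δ L)) :=
  rfl

/-- The factors `p` and `q` scale by `c` and `c²`, and `‖p‖⁻²` by `c⁻²`, leaving a single `c`. -/
theorem prodApprox_smul (Δ : HS H₂ H₂) (L : HS H H) (c : ℝ) (hc : c ≠ 0) :
    prodApprox H₁ Δ (c • L) = c • prodApprox H₁ Δ L := by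
  simp only [prodApprox_eq, map_smul, norm_smul, mul_pow, mul_inv, smul_smul, smul_apply,
    Real.norm_eq_abs, sq_abs]
  congr 1
  field_simp

theorem isOpen_partialProd₂_ne_zero (Δ : HS H₂ H₂) :
    IsOpen {L : HS H H | (partialProd₂ L Δ : HS H₁ H₁) ≠ 0} :=
  isOpen_ne_fun (partialProdL₂ Δ).continuous continuous_const

theorem continuousOn_prodApprox (Δ : HS H₂ H₂) :
    ContinuousOn (prodApprox H₁ Δ : HS H H → HS H H)
      {L | (partialProd₂ L Δ : HS H₁ H₁) ≠ 0} := by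
  change ContinuousOn (fun L => (‖partialProdL₂ (H₁ := H₁) Δ L‖ ^ 2)⁻¹ •
    HS.tensorB H₁ H₂ H (partialProdL₂ Δ L) (restackL H₁ H₂ H L (partialProdL₂ Δ L))) _
  have h : ContinuousOn (fun L : HS H H => (‖partialProdL₂ (H₁ := H₁) Δ L‖ ^ 2)⁻¹)
      {L | (partialProd₂ L Δ : HS H₁ H₁) ≠ 0} :=
    ContinuousOn.inv₀ (by fun_prop) fun L hL => pow_ne_zero 2 (norm_ne_zero_iff.2 hL)
  fun_prop

/-- `L` enters `q = P₁(L, P₂(L, Δ))` twice, so its derivative has two terms; the last term of the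
formula comes from differentiating `‖p‖⁻²`. -/
theorem exists_hasFDerivAt_prodApprox (Δ : HS H₂ H₂) {C : HS H H}
    (hC : (partialProd₂ C Δ : HS H₁ H₁) ≠ 0) :
    ∃ Φ' : HS H H →L[ℝ] HS H H, HasFDerivAt (prodApprox H₁ Δ) Φ' C ∧
      ∀ h, h - Φ' h = prodDeriv H₁ Δ C h := by
  have hp := (partialProdL₂ (H₁ := H₁) (H := H) Δ).hasFDerivAt (x := C)
  have hq := (restackL H₁ H₂ H).hasFDerivAt (x := C).clm_apply hp
  have hn := (hasDerivAt_inv (x := ‖partialProdL₂ (H₁ := H₁) Δ C‖ ^ 2)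
    (pow_ne_zero 2 (norm_ne_zero_iff.2 hC))).comp_hasFDerivAt C hp.norm_sq
  have h2 := hn.smul ((HS.tensorB H₁ H₂ H).hasFDerivAt_of_bilinear hp hq)
  refine ⟨_, h2, fun h => ?_⟩
  rw [prodDeriv]
  congr 1
  simp only [← HS.tensorB_apply, ← partialProdL₂_apply, ← restack_apply, ← restackL_apply]
  simp [ContinuousLinearMap.precompR, ContinuousLinearMap.precompL]
  rw [div_eq_inv_mul, real_inner_comm, ← pow_mul]
  abel

end PartialProducts

/-! ### Norm attainment and leading singular vectors of compact operators -/

section NormAttaining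

variable {E F : Type*} [NormedAddCommGroup E] [InnerProductSpace ℝ E] [CompleteSpace E]
  [NormedAddCommGroup F] [InnerProductSpace ℝ F] [CompleteSpace F]

open ContinuousLinearMap

/-- Expanding the square shows that near-maximizers of `‖S x‖` on the unit ball are approximate
eigenvectors of `S* S` for `‖S‖²`. -/
theorem norm_adjoint_comp_sub_sq_le (S : E →L[ℝ] F) {x : E} (hx : ‖x‖ ≤ 1) :
    ‖adjoint S (S x) - ‖S‖ ^ 2 • x‖ ^ 2 ≤ ‖S‖ ^ 2 * (‖S‖ ^ 2 - ‖S x‖ ^ 2) := by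
  have h1 : ‖adjoint S (S x)‖ ≤ ‖S‖ * ‖S x‖ := by
    simpa using (adjoint S).le_opNorm (S x)
  have h2 : ⟪adjoint S (S x), x⟫_ℝ = ‖S x‖ ^ 2 := by
    rw [adjoint_inner_left, real_inner_self_eq_norm_sq]
  have h3 : ‖adjoint S (S x)‖ ^ 2 ≤ ‖S‖ ^ 2 * ‖S x‖ ^ 2 := by
    rw [← mul_pow]
    gcongr
  have h4 : (‖S‖ ^ 2 * ‖x‖) ^ 2 ≤ (‖S‖ ^ 2) ^ 2 := by
    gcongr
    exact mul_le_of_le_one_right (sq_nonneg _) hx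
  rw [norm_sub_sq_real, inner_smul_right, h2, norm_smul, Real.norm_of_nonneg (sq_nonneg _)]
  linarith

/-- Unit vectors where the norm is attained are eigenvectors of `S* S`. -/
theorem adjoint_comp_eq_of_norm_eq {S : E →L[ℝ] F} {x : E} (hx : ‖x‖ = 1) (hS : ‖S x‖ = ‖S‖) :
    adjoint S (S x) = ‖S‖ ^ 2 • x := by
  have h := norm_adjoint_comp_sub_sq_le S hx.le
  rw [hS, sub_self, mul_zero] at h
  exact sub_eq_zero.1 (norm_eq_zero.1 (pow_eq_zero_iff two_ne_zero |>.1
    (le_antisymm h (sq_nonneg _))))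

/-- No normalization of `x` is required, so this applies to linear combinations of norm-attaining
vectors. -/
theorem norm_eq_of_adjoint_comp_eq {S : E →L[ℝ] F} {x : E}
    (hx : adjoint S (S x) = ‖S‖ ^ 2 • x) : ‖S x‖ = ‖S‖ * ‖x‖ := by
  rw [← sq_eq_sq₀ (norm_nonneg _) (by positivity), ← real_inner_self_eq_norm_sq,
    ← adjoint_inner_left, hx, real_inner_smul_left, real_inner_self_eq_norm_sq, mul_pow]

/-- The projection `x ↦ x - ⟪e, x⟫ e` onto the orthogonal complement of a unit vector `e`. -/
noncomputable def dropLine (e : E) : E →L[ℝ] E :=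
  ContinuousLinearMap.id ℝ E - InnerProductSpace.rankOne ℝ e e

theorem dropLine_apply (e x : E) : dropLine e x = x - ⟪e, x⟫_ℝ • e := rfl

theorem dropLine_of_inner_eq_zero {e x : E} (h : ⟪e, x⟫_ℝ = 0) : dropLine e x = x := by
  rw [dropLine_apply, h, zero_smul, sub_zero]

theorem dropLine_smul_self {e : E} (he : ‖e‖ = 1) (c : ℝ) : dropLine e (c • e) = 0 := by
  rw [dropLine_apply, inner_smul_right, real_inner_self_eq_norm_sq, he]
  simp

theorem inner_dropLine {e : E} (he : ‖e‖ = 1) (x : E) : ⟪e, dropLine e x⟫_ℝ = 0 := by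
  rw [dropLine_apply, inner_sub_right, inner_smul_right, real_inner_self_eq_norm_sq, he]
  ring

theorem norm_dropLine_sq {e : E} (he : ‖e‖ = 1) (x : E) :
    ‖dropLine e x‖ ^ 2 = ‖x‖ ^ 2 - ⟪e, x⟫_ℝ ^ 2 := by
  rw [dropLine_apply, norm_sub_sq_real, inner_smul_right, real_inner_comm, norm_smul, he,
    Real.norm_eq_abs, mul_one, sq_abs]
  ring

theorem norm_dropLine_le {e : E} (he : ‖e‖ = 1) (x : E) : ‖dropLine e x‖ ≤ ‖x‖ := by
  rw [← sq_le_sq₀ (norm_nonneg _) (norm_nonneg _), norm_dropLine_sq he]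
  linarith [sq_nonneg ⟪e, x⟫_ℝ]

/-- A nonzero compact operator attains its norm on the unit sphere. -/
theorem exists_norm_eq_of_isCompactOperator {S : E →L[ℝ] F} (hS : IsCompactOperator S)
    (h0 : S ≠ 0) : ∃ x, ‖x‖ = 1 ∧ ‖S x‖ = ‖S‖ := by
  have hpos : 0 < ‖S‖ := norm_pos_iff.2 h0
  have hex (n : ℕ) : ∃ x, ‖x‖ < 1 ∧ ‖S‖ - 1 / (n + 1 : ℝ) < ‖S x‖ :=
    S.exists_lt_apply_of_lt_opNorm (sub_lt_self _ (by positivity))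
  choose x hx1 hx2 using hex
  have hlim : Tendsto (fun n => ‖S (x n)‖) atTop (𝓝 ‖S‖) := by
    refine tendsto_of_tendsto_of_tendsto_of_le_of_le
      (g := fun n : ℕ => ‖S‖ - 1 / (n + 1 : ℝ)) (h := fun _ => ‖S‖) ?_ tendsto_const_nhds
      (fun n => (hx2 n).le) fun n => ?_
    · simpa using tendsto_one_div_add_atTop_nhds_zero_nat.const_sub ‖S‖
    · exact (S.le_opNorm _).trans (mul_le_of_le_one_right (norm_nonneg _) (hx1 n).le)
  -- Compactness makes `S* S xₙ` converge along a subsequence. Since `S* S xₙ - ‖S‖² xₙ → 0`, the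
  -- maximizing vectors themselves converge along it.
  have hM : IsCompactOperator (adjoint S ∘L S) := hS.clm_comp (adjoint S)
  obtain ⟨K, hK, hsub⟩ := hM.image_subset_compact_of_bounded
    (Metric.isBounded_closedBall (x := (0 : E)) (r := 1))
  obtain ⟨y, -, φ, hφ, hy⟩ := hK.tendsto_subseq (x := fun n => (adjoint S ∘L S) (x n))
    fun n => hsub ⟨x n, by simpa using (hx1 n).le, rfl⟩
  have hdiff : Tendsto (fun n => adjoint S (S (x n)) - ‖S‖ ^ 2 • x n) atTop (𝓝 0) := by
    have h1 : Tendsto (fun n => √(‖S‖ ^ 2 * (‖S‖ ^ 2 - ‖S (x n)‖ ^ 2))) atTop (𝓝 0) := by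
      have := (((hlim.pow 2).const_sub (‖S‖ ^ 2)).const_mul (‖S‖ ^ 2)).sqrt
      simpa using this
    exact squeeze_zero_norm (fun n => Real.le_sqrt_of_sq_le
      (norm_adjoint_comp_sub_sq_le S (hx1 n).le)) h1
  have hx : Tendsto (fun n => x (φ n)) atTop (𝓝 ((‖S‖ ^ 2)⁻¹ • y)) := by
    have h1 := (hy.sub (hdiff.comp hφ.tendsto_atTop)).const_smul (‖S‖ ^ 2)⁻¹
    simp only [sub_zero] at h1
    refine h1.congr fun n => ?_
    simp only [Function.comp_apply, ContinuousLinearMap.comp_apply, sub_sub_cancel]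
    rw [inv_smul_smul₀ (pow_pos hpos 2).ne']
  set e := (‖S‖ ^ 2)⁻¹ • y
  have hSe : ‖S e‖ = ‖S‖ :=
    tendsto_nhds_unique ((S.continuous.norm.tendsto e).comp hx) (hlim.comp hφ.tendsto_atTop)
  -- The limit lies in the closed unit ball, and `‖S‖ = ‖S e‖ ≤ ‖S‖ ‖e‖` forces norm one.
  refine ⟨e, le_antisymm (le_of_tendsto hx.norm (.of_forall fun n => (hx1 _).le)) ?_, hSe⟩
  have := S.le_opNorm e
  rw [hSe] at this
  exact le_of_mul_le_mul_left (by simpa using this) hpos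

theorem isSingularTriple_of_norm_eq {S : E →L[ℝ] F} (h0 : S ≠ 0) {x : E} (hx : ‖x‖ = 1)
    (hS : ‖S x‖ = ‖S‖) : IsSingularTriple S ‖S‖ x (‖S‖⁻¹ • S x) := by
  have hpos : 0 < ‖S‖ := norm_pos_iff.2 h0
  refine ⟨norm_nonneg _, hx, ?_, (smul_inv_smul₀ hpos.ne' _).symm, ?_⟩
  · rw [norm_smul, hS, norm_inv, norm_norm, inv_mul_cancel₀ hpos.ne']
  · rw [map_smul, adjoint_comp_eq_of_norm_eq hx hS, smul_smul]
    congr 1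
    field_simp

theorem IsSingularTriple.norm_apply {S : E →L[ℝ] F} {γ : ℝ} {e : E} {f : F}
    (h : IsSingularTriple S γ e f) : ‖S e‖ = γ := by
  rw [h.2.2.2.1, norm_smul, h.2.2.1, mul_one, Real.norm_of_nonneg h.1]

theorem IsSingularTriple.le_norm {S : E →L[ℝ] F} {γ : ℝ} {e : E} {f : F}
    (h : IsSingularTriple S γ e f) : γ ≤ ‖S‖ := by
  rw [← h.norm_apply]
  simpa [h.2.1] using S.le_opNorm e

/-- The largest singular value of a nonzero compact operator is its norm. -/
theorem IsTopSingularTriple.eq_norm {S : E →L[ℝ] F} (hS : IsCompactOperator S) (h0 : S ≠ 0)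
    {γ : ℝ} {e : E} {f : F} (h : IsTopSingularTriple S γ e f) : γ = ‖S‖ := by
  obtain ⟨x, hx, hSx⟩ := exists_norm_eq_of_isCompactOperator hS h0
  exact le_antisymm h.1.le_norm (h.2 _ _ _ (isSingularTriple_of_norm_eq h0 hx hSx))

theorem exists_isTopSingularTriple {S : E →L[ℝ] F} (hS : IsCompactOperator S) (h0 : S ≠ 0) :
    ∃ e f, IsTopSingularTriple S ‖S‖ e f := by
  obtain ⟨x, hx, hSx⟩ := exists_norm_eq_of_isCompactOperator hS h0
  exact ⟨x, _, isSingularTriple_of_norm_eq h0 hx hSx, fun _ _ _ h => h.le_norm⟩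

end NormAttaining

/-! ### Best approximation by simple tensors, uniqueness and the spectral gap -/

section BestTensor

open HilbertTensor ContinuousLinearMap

variable (E F : Type*) {G : Type*} [NormedAddCommGroup E] [InnerProductSpace ℝ E]
  [CompleteSpace E] [NormedAddCommGroup F] [InnerProductSpace ℝ F] [CompleteSpace F]
  [NormedAddCommGroup G] [InnerProductSpace ℝ G] [CompleteSpace G] [HilbertTensor E F G]

/-- `T` is a best approximation of `L` among the simple tensors. -/
def IsBestTensor (L T : G) : Prop :=
  (∃ (A : E) (B : F), T = tmul A B) ∧
    ∀ (A : E) (B : F), ‖L - T‖ ^ 2 ≤ ‖L - tmul A B‖ ^ 2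

/-- `R` identifies elements of `E ⊗ F` with operators from `E` to `F`. -/
def IsTensorToOp (R : G →L[ℝ] E →L[ℝ] F) : Prop :=
  ∀ L A B, ⟪R L A, B⟫_ℝ = ⟪L, tmul A B⟫_ℝ

/-- The elements with a unique best approximation by simple tensors. -/
def uniqueBest (R : G →L[ℝ] E →L[ℝ] F) : Set G := {L | R L ≠ 0 ∧ ∃! T, IsBestTensor E F L T}

variable {E F}
variable {R : G →L[ℝ] E →L[ℝ] F}

theorem IsTensorToOp.apply_tmul (hR : IsTensorToOp E F R) (a x : E) (b : F) :
    R (tmul a b) x = ⟪a, x⟫_ℝ • b :=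
  ext_inner_right ℝ fun B => by rw [hR, inner_tmul, real_inner_smul_left]

/-- Simple tensors give operators of rank at most one, their span is dense, and the compact
operators are closed in operator norm. -/
theorem IsTensorToOp.isCompactOperator (hR : IsTensorToOp E F R) (L : G) :
    IsCompactOperator (R L) := by
  let W : Submodule ℝ G := (compactOperator (RingHom.id ℝ) E F).comap R.toLinearMap
  have hW : IsClosed (W : Set G) := isClosed_setOfPred_isCompactOperator.preimage R.continuous
  have hsub : Submodule.span ℝ (Set.range fun p : E × F => (tmul p.1 p.2 : G)) ≤ W := by
    rw [Submodule.span_le]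
    rintro _ ⟨⟨a, b⟩, rfl⟩
    change IsCompactOperator (R (tmul a b))
    have h1 : R (tmul a b) = toSpanSingleton ℝ b ∘L innerSL ℝ a := by
      ext x
      simp [hR.apply_tmul]
    rw [h1]
    exact (isCompactOperator_of_locallyCompactSpace_dom
      (innerSL ℝ a)).clm_comp (toSpanSingleton ℝ b)
  have := hW.closure_subset_iff.2 hsub (dense_tmul (H₁ := E) (H₂ := F) L)
  exact this

/-- `R L` records all inner products of `L` with simple tensors, and these are total. -/
theorem IsTensorToOp.eq_zero (hR : IsTensorToOp E F R) {L : G} (h : R L = 0) : L = 0 := by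
  have h1 : innerSL ℝ L = 0 := clm_ext_tmul (H₁ := E) (H₂ := F) fun x y => by
    simp [← hR L x y, h]
  have : ⟪L, L⟫_ℝ = 0 := by simpa using congrArg (fun T : G →L[ℝ] ℝ => T L) h1
  exact inner_self_eq_zero.1 this

theorem IsTensorToOp.norm_sub_tmul_sq (hR : IsTensorToOp E F R) (L : G) (A : E) (B : F) :
    ‖L - tmul A B‖ ^ 2 = ‖L‖ ^ 2 - 2 * ⟪R L A, B⟫_ℝ + (‖A‖ * ‖B‖) ^ 2 := by
  rw [norm_sub_sq_real, hR, norm_tmul]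

/-- With `s = ‖A‖ ‖B‖`, the squared error is at least `‖L‖² - 2‖R L‖ s + s²`, minimal at `s = ‖R
L‖`; the given tensor attains this minimum. -/
theorem IsTensorToOp.isBestTensor_of_norm_eq (hR : IsTensorToOp E F R) {L : G} {x : E}
    (hx : ‖x‖ = 1) (hS : ‖R L x‖ = ‖R L‖) : IsBestTensor E F L (tmul x (R L x)) := by
  refine ⟨⟨_, _, rfl⟩, fun A B => ?_⟩
  rw [hR.norm_sub_tmul_sq, hR.norm_sub_tmul_sq, real_inner_self_eq_norm_sq, hx, hS]
  have h1 : ⟪R L A, B⟫_ℝ ≤ ‖R L‖ * (‖A‖ * ‖B‖) := by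
    rw [← mul_assoc]
    exact (real_inner_le_norm _ _).trans (by gcongr; exact (R L).le_opNorm A)
  nlinarith [sq_nonneg (‖R L‖ - ‖A‖ * ‖B‖)]

/-- A minimizer must attain equality both in the completed square and in Cauchy-Schwarz, which
forces `B` to be a multiple of `R L A`. -/
theorem IsTensorToOp.isBestTensor_iff (hR : IsTensorToOp E F R) {L : G} (h0 : R L ≠ 0) {T : G} :
    IsBestTensor E F L T ↔ ∃ x, ‖x‖ = 1 ∧ ‖R L x‖ = ‖R L‖ ∧ T = tmul x (R L x) := by
  refine ⟨?_, fun ⟨x, hx, hS, hT⟩ => hT ▸ hR.isBestTensor_of_norm_eq hx hS⟩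
  rintro ⟨⟨A, B, rfl⟩, hmin⟩
  obtain ⟨x, hx, hS⟩ := exists_norm_eq_of_isCompactOperator (hR.isCompactOperator L) h0
  have hpos : 0 < ‖R L‖ := norm_pos_iff.2 h0
  have h1 := hmin x (R L x)
  rw [hR.norm_sub_tmul_sq, hR.norm_sub_tmul_sq, real_inner_self_eq_norm_sq, hx, hS] at h1
  have h2 : ⟪R L A, B⟫_ℝ ≤ ‖R L‖ * (‖A‖ * ‖B‖) := by
    rw [← mul_assoc]
    exact (real_inner_le_norm _ _).trans (by gcongr; exact (R L).le_opNorm A)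
  -- Comparison with a norm-attaining competitor leaves `(‖A‖ ‖B‖ - ‖R L‖)² ≤ 0`.
  have h3 : ‖A‖ * ‖B‖ = ‖R L‖ := by
    have : (‖A‖ * ‖B‖ - ‖R L‖) ^ 2 = 0 := le_antisymm (by nlinarith) (sq_nonneg _)
    nlinarith [pow_eq_zero_iff two_ne_zero |>.1 this]
  have hA : ‖A‖ ≠ 0 := fun h => hpos.ne' (by rw [← h3, h, zero_mul])
  have h4 : ‖R L‖ ^ 2 ≤ ⟪R L A, B⟫_ℝ := by
    rw [h3] at h1
    nlinarith
  set a := ‖A‖⁻¹ • A with ha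
  have hna : ‖a‖ = 1 := by rw [ha, norm_smul, norm_inv, norm_norm, inv_mul_cancel₀ hA]
  have hle : ‖R L a‖ ≤ ‖R L‖ := by simpa [hna] using (R L).le_opNorm a
  have hin : ⟪R L a, ‖A‖ • B⟫_ℝ = ⟪R L A, B⟫_ℝ := by
    rw [ha, map_smul, real_inner_smul_left, real_inner_smul_right, inv_mul_cancel_left₀ hA]
  have hnB : ‖‖A‖ • B‖ = ‖R L‖ := by rw [norm_smul, norm_norm, h3]
  -- Equality case of Cauchy-Schwarz: `‖A‖ B` has norm `‖R L‖`, `R L a` has at most that norm, and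
  -- their inner product is at least `‖R L‖²`.
  have hB : R L a = ‖A‖ • B := by
    have : ‖R L a - ‖A‖ • B‖ ^ 2 ≤ 0 := by
      rw [norm_sub_sq_real, hin, hnB]
      have := pow_le_pow_left₀ (norm_nonneg _) hle 2
      linarith
    exact sub_eq_zero.1 (norm_eq_zero.1 (pow_eq_zero_iff two_ne_zero |>.1
      (le_antisymm this (sq_nonneg _))))
  refine ⟨a, hna, by rw [hB, hnB], ?_⟩
  rw [hB, ha, map_smul, map_smul, LinearMap.smul_apply, smul_inv_smul₀ hA]

/-- If `R L` is smaller than its norm on the orthogonal complement of a line, then `L` has a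
unique best approximation. -/
theorem IsTensorToOp.mem_uniqueBest (hR : IsTensorToOp E F R) {L : G} {e : E} {c : ℝ}
    (hc0 : 0 ≤ c) (hc : c < ‖R L‖) (h : ∀ x, ⟪e, x⟫_ℝ = 0 → ‖R L x‖ ≤ c * ‖x‖) :
    L ∈ uniqueBest E F R := by
  have h0 : R L ≠ 0 := norm_pos_iff.1 (hc0.trans_lt hc)
  obtain ⟨a, ha, hSa⟩ := exists_norm_eq_of_isCompactOperator (hR.isCompactOperator L) h0
  refine ⟨h0, _, hR.isBestTensor_of_norm_eq ha hSa, fun T hT => ?_⟩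
  obtain ⟨b, hb, hSb, rfl⟩ := (hR.isBestTensor_iff h0).1 hT
  -- The gap excludes nonzero eigenvectors for `‖R L‖²` orthogonal to `e`.
  have hker {w : E} (hw : adjoint (R L) (R L w) = ‖R L‖ ^ 2 • w) (hwe : ⟪e, w⟫_ℝ = 0) :
      w = 0 := by
    by_contra hne
    have h1 := h w hwe
    rw [norm_eq_of_adjoint_comp_eq hw] at h1
    exact absurd (le_of_mul_le_mul_right h1 (norm_pos_iff.2 hne)) hc.not_ge
  have hea : ⟪e, a⟫_ℝ ≠ 0 := fun h1 => by
    have := hker (adjoint_comp_eq_of_norm_eq ha hSa) h1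
    simp [this] at ha
  -- This combination stays in the eigenspace and is orthogonal to `e`, so the two norm-attaining
  -- vectors are proportional.
  have hw : ⟪e, a⟫_ℝ • b - ⟪e, b⟫_ℝ • a = 0 := by
    refine hker ?_ ?_
    · simp only [map_sub, map_smul, adjoint_comp_eq_of_norm_eq ha hSa,
        adjoint_comp_eq_of_norm_eq hb hSb, smul_sub, smul_comm (‖R L‖ ^ 2)]
    · rw [inner_sub_right, inner_smul_right, inner_smul_right]
      ring
  obtain ⟨t, rfl⟩ : ∃ t : ℝ, b = t • a :=
    ⟨(⟪e, a⟫_ℝ)⁻¹ * ⟪e, b⟫_ℝ, by rw [mul_smul, ← sub_eq_zero.1 hw, inv_smul_smul₀ hea]⟩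
  have ht : t * t = 1 := by
    rw [norm_smul, ha, mul_one, Real.norm_eq_abs] at hb
    rw [← abs_mul_abs_self, hb, one_mul]
  -- The tensor `x ⊗ R L x` is quadratic in `x`, so the sign `t = ±1` disappears.
  rw [map_smul, map_smul, map_smul, LinearMap.smul_apply, smul_smul, ht, one_smul]

/-- If `L` has a unique best approximation, then `R L` has a spectral gap. -/
theorem IsTensorToOp.exists_gap (hR : IsTensorToOp E F R) {L : G} (hL : L ∈ uniqueBest E F R)
    {e : E} (he : ‖e‖ = 1) (hSe : ‖R L e‖ = ‖R L‖) :
    ∃ c, 0 ≤ c ∧ c < ‖R L‖ ∧ ∀ x, ⟪e, x⟫_ℝ = 0 → ‖R L x‖ ≤ c * ‖x‖ := by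
  have hpos : 0 < ‖R L‖ := norm_pos_iff.2 hL.1
  set P : E →L[ℝ] E := dropLine e
  have hPn (x : E) : ‖P x‖ ≤ ‖x‖ := norm_dropLine_le he x
  have hle : ‖R L ∘L P‖ ≤ ‖R L‖ :=
    opNorm_le_bound _ (norm_nonneg _) fun x => ((R L).le_opNorm _).trans (by gcongr; exact hPn x)
  refine ⟨‖R L ∘L P‖, norm_nonneg _, lt_of_le_of_ne hle fun heq => ?_, fun x hx => ?_⟩
  -- Without a gap, the compact operator `R L ∘L P` would attain the norm `‖R L‖`, which yields a
  -- norm-attaining unit vector orthogonal to `e` and hence a second best tensor.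
  · have hne : R L ∘L P ≠ 0 := norm_pos_iff.1 (by rwa [heq])
    obtain ⟨x, hx, hSx⟩ := exists_norm_eq_of_isCompactOperator
      ((hR.isCompactOperator L).comp_clm P) hne
    rw [heq, ContinuousLinearMap.comp_apply] at hSx
    have hPx : ‖P x‖ = 1 := by
      refine le_antisymm ((hPn x).trans hx.le) ?_
      have := (R L).le_opNorm (P x)
      rw [hSx] at this
      exact le_of_mul_le_mul_left (by simpa using this) hpos
    have h1 := hL.2.unique (hR.isBestTensor_of_norm_eq hPx hSx)
      (hR.isBestTensor_of_norm_eq he hSe)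
    -- The two best tensors are orthogonal because their first factors are; being equal, they would
    -- vanish.
    have h2 : ‖(tmul (P x) (R L (P x)) : G)‖ ^ 2 = 0 := by
      rw [← real_inner_self_eq_norm_sq]
      nth_rewrite 1 [h1]
      rw [inner_tmul, inner_dropLine he, zero_mul]
    rw [norm_tmul, hPx, hSx, one_mul] at h2
    exact hpos.ne' (pow_eq_zero_iff two_ne_zero |>.1 h2)
  · have := (R L ∘L P).le_opNorm x
    rwa [ContinuousLinearMap.comp_apply, dropLine_of_inner_eq_zero hx] at this

/-- Any `c'` strictly between `c` and `‖R L₀‖` absorbs a perturbation of operator norm less than `c'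
- c`. The line spanned by `e` stays fixed, so leading vectors of nearby operators need not be
followed. -/
theorem IsTensorToOp.eventually_gap (hR : IsTensorToOp E F R) {L₀ : G} {e : E} {c : ℝ}
    (hc : c < ‖R L₀‖) (h : ∀ x, ⟪e, x⟫_ℝ = 0 → ‖R L₀ x‖ ≤ c * ‖x‖) :
    ∃ c', c < c' ∧ ∀ᶠ L in 𝓝 L₀, c' < ‖R L‖ ∧ ∀ x, ⟪e, x⟫_ℝ = 0 → ‖R L x‖ ≤ c' * ‖x‖ := by
  obtain ⟨c', h1, h2⟩ := exists_between hc
  refine ⟨c', h1, ?_⟩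
  have e1 : ∀ᶠ L in 𝓝 L₀, c' < ‖R L‖ := (R.continuous.norm.tendsto L₀).eventually_const_lt h2
  have e2 : ∀ᶠ L in 𝓝 L₀, ‖R L - R L₀‖ < c' - c := by
    have : Tendsto (fun L => ‖R L - R L₀‖) (𝓝 L₀) (𝓝 0) := by
      have h : Continuous fun L => ‖R L - R L₀‖ := by fun_prop
      simpa using h.tendsto L₀
    exact this.eventually_lt_const (sub_pos.2 h1)
  filter_upwards [e1, e2] with L hL1 hL2
  refine ⟨hL1, fun x hx => ?_⟩
  calc ‖R L x‖ = ‖R L₀ x + (R L - R L₀) x‖ := by simp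
    _ ≤ c * ‖x‖ + (c' - c) * ‖x‖ :=
      norm_add_le_of_le (h x hx) (((R L - R L₀).le_opNorm x).trans (by gcongr))
    _ = c' * ‖x‖ := by ring

/-- Uniqueness gives a gap, a gap persists nearby, and a gap gives uniqueness back. -/
theorem IsTensorToOp.isOpen_uniqueBest (hR : IsTensorToOp E F R) : IsOpen (uniqueBest E F R) := by
  rw [isOpen_iff_mem_nhds]
  intro L₀ hL
  obtain ⟨e, he, hSe⟩ := exists_norm_eq_of_isCompactOperator (hR.isCompactOperator L₀) hL.1
  obtain ⟨c, hc0, hc, h⟩ := hR.exists_gap hL he hSe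
  obtain ⟨c', hc', hev⟩ := hR.eventually_gap hc h
  filter_upwards [hev] with L hL'
  exact hR.mem_uniqueBest (hc0.trans hc'.le) hL'.1 hL'.2

theorem isBestTensor_smul {L T : G} (h : IsBestTensor E F L T) {c : ℝ} (hc : c ≠ 0) :
    IsBestTensor E F (c • L) (c • T) := by
  obtain ⟨⟨A, B, rfl⟩, hmin⟩ := h
  refine ⟨⟨c • A, B, by simp⟩, fun A' B' => ?_⟩
  have h1 : c • L - tmul A' B' = c • (L - tmul (c⁻¹ • A') B') := by
    rw [smul_sub, map_smul, LinearMap.smul_apply, smul_inv_smul₀ hc]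
  rw [h1, ← smul_sub, norm_smul, norm_smul, mul_pow, mul_pow]
  gcongr ?_ * ?_
  exact hmin _ _

theorem smul_mem_uniqueBest {L : G} (hL : L ∈ uniqueBest E F R) {c : ℝ} (hc : c ≠ 0) :
    c • L ∈ uniqueBest E F R := by
  obtain ⟨h0, T, hT, huniq⟩ := hL
  refine ⟨by simpa [hc] using h0, c • T, isBestTensor_smul hT hc, fun T' hT' => ?_⟩
  have := isBestTensor_smul hT' (inv_ne_zero hc)
  rw [inv_smul_smul₀ hc] at this
  rw [← huniq _ this, smul_inv_smul₀ hc]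

end BestTensor

/-! ### Invertibility of the shifted operator from the spectral gap -/

section Resolvent

open ContinuousLinearMap

variable {E F : Type*} [NormedAddCommGroup E] [InnerProductSpace ℝ E] [CompleteSpace E]
  [NormedAddCommGroup F] [InnerProductSpace ℝ F] [CompleteSpace F]

variable (E F) in
/-- The adjoint as a linear map over the reals. -/
noncomputable def adjointRealL : (E →L[ℝ] F) →L[ℝ] (F →L[ℝ] E) :=
  LinearMap.mkContinuous
    { toFun := fun S => adjoint S
      map_add' := fun S T => map_add _ S T
      map_smul' := fun c S => by simp } 1
    fun S => by simp

@[simp] theorem adjointRealL_apply (S : E →L[ℝ] F) : adjointRealL E F S = adjoint S := rfl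

/-- If `S` attains its norm at `e`, with a gap on the orthogonal complement of `e`, then
`‖S‖² - S* S + ‖S‖² ⟪e, ·⟫ e` is invertible. -/
theorem exists_resolvent {S : E →L[ℝ] F} {e : E} {c : ℝ} (he : ‖e‖ = 1) (hSe : ‖S e‖ = ‖S‖)
    (hc0 : 0 ≤ c) (hc : c < ‖S‖) (h : ∀ x, ⟪e, x⟫_ℝ = 0 → ‖S x‖ ≤ c * ‖x‖) :
    ∃ Q Qi : E →L[ℝ] E,
      (∀ x, Q x = ‖S‖ ^ 2 • x - adjoint S (S x) + (‖S‖ ^ 2 * ⟪e, x⟫_ℝ) • e) ∧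
      (∀ x, Qi (Q x) = x) ∧ ∀ x, Q (Qi x) = x := by
  -- The rank-one term fills the kernel direction `e` of `‖S‖² - S* S` and changes nothing on its
  -- orthogonal complement.
  let Q : E →L[ℝ] E := ‖S‖ ^ 2 • ContinuousLinearMap.id ℝ E - adjoint S ∘L S +
    ‖S‖ ^ 2 • InnerProductSpace.rankOne ℝ e e
  have hQ (x : E) : Q x = ‖S‖ ^ 2 • x - adjoint S (S x) + (‖S‖ ^ 2 * ⟪e, x⟫_ℝ) • e := by
    simp [Q, mul_smul]
  have hpos : 0 < ‖S‖ ^ 2 - c ^ 2 := sub_pos.2 (by gcongr)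
  have hcoer (x : E) : (‖S‖ ^ 2 - c ^ 2) * ‖x‖ ^ 2 ≤ ⟪Q x, x⟫_ℝ := by
    have h1 : ⟪Q x, x⟫_ℝ = ‖S‖ ^ 2 * ‖x‖ ^ 2 - ‖S x‖ ^ 2 + ‖S‖ ^ 2 * ⟪e, x⟫_ℝ ^ 2 := by
      rw [hQ, inner_add_left, inner_sub_left, real_inner_smul_left, real_inner_smul_left,
        adjoint_inner_left, real_inner_self_eq_norm_sq, real_inner_self_eq_norm_sq]
      ring
    have h2 : ‖S x‖ ^ 2 = ‖S‖ ^ 2 * ⟪e, x⟫_ℝ ^ 2 + ‖S (dropLine e x)‖ ^ 2 := by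
      have hx : S x = ⟪e, x⟫_ℝ • S e + S (dropLine e x) := by
        rw [dropLine_apply, map_sub, map_smul]
        abel
      have horth : ⟪S e, S (dropLine e x)⟫_ℝ = 0 := by
        rw [← adjoint_inner_left, adjoint_comp_eq_of_norm_eq he hSe, real_inner_smul_left,
          inner_dropLine he, mul_zero]
      rw [hx, norm_add_sq_real, real_inner_smul_left, horth, norm_smul, hSe, mul_pow,
        Real.norm_eq_abs, sq_abs]
      ring
    have h3 : ‖S (dropLine e x)‖ ^ 2 ≤ c ^ 2 * (‖x‖ ^ 2 - ⟪e, x⟫_ℝ ^ 2) := by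
      rw [← norm_dropLine_sq he, ← mul_pow]
      exact pow_le_pow_left₀ (norm_nonneg _) (h _ (inner_dropLine he x)) 2
    rw [h1, h2]
    nlinarith [mul_nonneg (sq_nonneg c) (sq_nonneg ⟪e, x⟫_ℝ)]
  -- Lax-Milgram: the coercivity constant `‖S‖² - c²` is positive by the gap.
  obtain ⟨U, hU⟩ : IsUnit Q :=
    isUnit_of_forall_le_norm_inner_map Q (c := ⟨_, hpos.le⟩) hpos fun x => by
      rw [mul_comm]
      exact (hcoer x).trans (le_abs_self _)
  refine ⟨Q, (U⁻¹ : (E →L[ℝ] E)ˣ), hQ, fun x => ?_, fun x => ?_⟩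
  · rw [← hU]
    exact congrArg (fun T : E →L[ℝ] E => T x) U.inv_mul
  · rw [← hU]
    exact congrArg (fun T : E →L[ℝ] E => T x) U.mul_inv

end Resolvent

/-! ### First-order perturbation of the leading eigenvector -/

section Perturbation

open ContinuousLinearMap

variable {E F G : Type*} [NormedAddCommGroup E] [InnerProductSpace ℝ E] [CompleteSpace E]
  [NormedAddCommGroup F] [InnerProductSpace ℝ F] [CompleteSpace F]
  [NormedAddCommGroup G] [NormedSpace ℝ G]

/-- First-order perturbation of the leading eigenvector `e` of `S* S`, where `S = R L`: if `e + x L`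
with `x L ⟂ e` is an eigenvector for `‖R L‖²`, then `x` is Fréchet differentiable. -/
theorem hasFDerivAt_eigenvector {R : G →L[ℝ] E →L[ℝ] F} {L₀ : G} {e : E} (he : ‖e‖ = 1)
    (hSe : ‖R L₀ e‖ = ‖R L₀‖) {Q Qi : E →L[ℝ] E}
    (hQ : ∀ x, Q x =
      ‖R L₀‖ ^ 2 • x - adjoint (R L₀) (R L₀ x) + (‖R L₀‖ ^ 2 * ⟪e, x⟫_ℝ) • e)
    (hQi : ∀ x, Qi (Q x) = x) {x : G → E}
    (hx : ∀ᶠ L in 𝓝 L₀, ⟪e, x L⟫_ℝ = 0 ∧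
      adjoint (R L) (R L (e + x L)) = ‖R L‖ ^ 2 • (e + x L)) :
    x L₀ = 0 ∧ ∃ x' : G →L[ℝ] E, HasFDerivAt x x' L₀ ∧ ∀ h, x' h =
      Qi (dropLine e (adjoint (R L₀) (R h e) + adjoint (R h) (R L₀ e))) := by
  set P : E →L[ℝ] E := dropLine e
  -- `N` is the perturbation of `S* S`, `w` the candidate first-order solution, and `η` the relative
  -- error of replacing `x` by `w`.
  let N : G → E →L[ℝ] E := fun L => adjointRealL E F (R L) ∘L R L - adjoint (R L₀) ∘L R L₀
  let w : G → E := fun L => Qi (P (adjointRealL E F (R L) (R L e)))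
  let η : G → ℝ := fun L => ‖Qi‖ * (‖N L‖ + |‖R L₀‖ ^ 2 - ‖R L‖ ^ 2|)
  have hη : Tendsto η (𝓝 L₀) (𝓝 0) := by
    have h1 : Continuous η := by fun_prop
    have h2 : η L₀ = 0 := by simp [η, N]
    simpa [h2] using h1.tendsto L₀
  have hM₀ : adjoint (R L₀) (R L₀ e) = ‖R L₀‖ ^ 2 • e := adjoint_comp_eq_of_norm_eq he hSe
  have hw0 : w L₀ = 0 := by
    simp only [w, adjointRealL_apply, hM₀, P, dropLine_smul_self he, map_zero]
  have hr : ∀ᶠ L in 𝓝 L₀, ‖x L - w L‖ ≤ η L * ‖x L‖ := by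
    filter_upwards [hx] with L ⟨hL1, hL2⟩
    have hQx : Q (x L) = ‖R L₀‖ ^ 2 • x L - adjoint (R L₀) (R L₀ (x L)) := by
      rw [hQ, hL1, mul_zero, zero_smul, add_zero]
    have hPQ : P (Q (x L)) = Q (x L) := by
      refine dropLine_of_inner_eq_zero ?_
      rw [hQx, inner_sub_right, inner_smul_right, hL1, adjoint_inner_right, ← adjoint_inner_left,
        hM₀, real_inner_smul_left, hL1]
      ring
    have hPx : P (x L) = x L := dropLine_of_inner_eq_zero hL1
    -- The perturbed eigenvalue equation rearranged around `L₀`. Applying `P` then kills the term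
    -- along `e`, so the varying eigenvalue survives only as a coefficient of the small vector `x
    -- L`.
    have hQx' : Q (x L) = (‖R L₀‖ ^ 2 - ‖R L‖ ^ 2) • x L + adjoint (R L) (R L e) -
        ‖R L‖ ^ 2 • e + N L (x L) := by
      have hN : N L (x L) = adjoint (R L) (R L (x L)) - adjoint (R L₀) (R L₀ (x L)) := rfl
      rw [map_add, map_add, smul_add] at hL2
      rw [hQx, hN, sub_smul, ← sub_eq_zero]
      rw [← sub_eq_zero] at hL2
      rw [← neg_eq_zero, ← hL2]
      abel
    have h1 : Q (x L) = (‖R L₀‖ ^ 2 - ‖R L‖ ^ 2) • x L + P (adjoint (R L) (R L e)) +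
        P (N L (x L)) := by
      rw [← hPQ, hQx', map_add, map_sub, map_add, map_smul, hPx, dropLine_smul_self he, sub_zero]
    have h2 : x L - w L = Qi ((‖R L₀‖ ^ 2 - ‖R L‖ ^ 2) • x L + P (N L (x L))) := by
      nth_rewrite 1 [← hQi (x L)]
      rw [h1, ← map_sub Qi]
      congr 1
      change _ - P (adjoint (R L) (R L e)) = _
      rw [add_right_comm, add_sub_cancel_right]
    rw [h2]
    calc _ ≤ ‖Qi‖ * ‖(‖R L₀‖ ^ 2 - ‖R L‖ ^ 2) • x L + P (N L (x L))‖ := Qi.le_opNorm _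
      _ ≤ ‖Qi‖ * (|‖R L₀‖ ^ 2 - ‖R L‖ ^ 2| * ‖x L‖ + ‖N L‖ * ‖x L‖) := by
        gcongr
        refine norm_add_le_of_le (norm_smul _ _).le ?_
        exact (norm_dropLine_le he _).trans ((N L).le_opNorm _)
      _ = η L * ‖x L‖ := by
        simp only [η]
        ring
  -- Once `η ≤ 1/2`, the error is absorbed into the left side. This gives `x = O(L - L₀)` without
  -- assuming that `x` is continuous.
  have hx_le : ∀ᶠ L in 𝓝 L₀, ‖x L‖ ≤ 2 * ‖w L‖ := by
    filter_upwards [hr, hη.eventually_lt_const (show (0 : ℝ) < 1 / 2 by norm_num)] with L h1 h2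
    have h3 : ‖x L‖ ≤ ‖x L - w L‖ + ‖w L‖ := by simpa using norm_add_le (x L - w L) (w L)
    nlinarith [norm_nonneg (x L)]
  have hx0 : x L₀ = 0 := by simpa [hw0] using hx_le.self_of_nhds
  have hadj : HasFDerivAt (fun L => adjointRealL E F (R L)) _ L₀ :=
    (adjointRealL E F ∘L R).hasFDerivAt
  have hRe : HasFDerivAt (fun L => R L e) (R.flip e) L₀ := (R.flip e).hasFDerivAt
  have hw : HasFDerivAt w _ L₀ := (Qi ∘L P).hasFDerivAt.comp L₀ (hadj.clm_apply hRe)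
  have hxO : x =O[𝓝 L₀] fun L => L - L₀ := by
    have h1 : w =O[𝓝 L₀] fun L => L - L₀ := by
      simpa [hw0] using hw.isBigO_sub
    exact (Asymptotics.IsBigO.of_bound 2 hx_le).trans h1
  -- The error is `o(1) ‖x‖ = o(L - L₀)`, so `x` and `w` have the same derivative.
  have hrd : HasFDerivAt (fun L => x L - w L) (0 : G →L[ℝ] E) L₀ := by
    rw [hasFDerivAt_iff_isLittleO]
    simp only [hx0, hw0, sub_zero, zero_apply]
    refine Asymptotics.IsLittleO.trans_isBigO ?_ hxO
    rw [Asymptotics.isLittleO_iff]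
    intro ε hε
    filter_upwards [hr, hη.eventually_lt_const hε] with L h1 h2
    exact h1.trans (by gcongr)
  have hfin := hrd.add hw
  refine ⟨hx0, _, hfin.congr_of_eventuallyEq (.of_forall fun L => by simp), fun h => ?_⟩
  simp [P]

end Perturbation

/-! ### Differentiability of the best simple tensor -/

section BestTensorDeriv

open HilbertTensor ContinuousLinearMap

variable {E F G : Type*} [NormedAddCommGroup E] [InnerProductSpace ℝ E]
  [CompleteSpace E] [NormedAddCommGroup F] [InnerProductSpace ℝ F] [CompleteSpace F]
  [NormedAddCommGroup G] [InnerProductSpace ℝ G] [CompleteSpace G] [HilbertTensor E F G]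
  {R : G →L[ℝ] E →L[ℝ] F}

variable (E F G) in
/-- The simple tensors as a bounded bilinear map. -/
noncomputable def tmulB : E →L[ℝ] F →L[ℝ] G :=
  LinearMap.mkContinuous₂ tmul 1 fun x y => by simpa using (norm_tmul x y).le

@[simp] theorem tmulB_apply (x : E) (y : F) : tmulB E F G x y = tmul x y := rfl

/-- The best approximation by simple tensors is Fréchet differentiable where it is unique. -/
theorem IsTensorToOp.exists_hasFDerivAt (hR : IsTensorToOp E F R) {L₀ : G}
    (hL₀ : L₀ ∈ uniqueBest E F R) {e : E} (he : ‖e‖ = 1) (hSe : ‖R L₀ e‖ = ‖R L₀‖)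
    {Φ : G → G} (hΦ : ∀ L ∈ uniqueBest E F R, IsBestTensor E F L (Φ L)) :
    ∃ Φ' : G →L[ℝ] G, HasFDerivAt Φ Φ' L₀ ∧ ∀ h, ∃ u, ⟪e, u⟫_ℝ = 0 ∧
      ‖R L₀‖ ^ 2 • u - adjoint (R L₀) (R L₀ u) =
        dropLine e (adjoint (R L₀) (R h e) + adjoint (R h) (R L₀ e)) ∧
      Φ' h = tmul u (R L₀ e) + tmul e (R h e + R L₀ u) := by
  obtain ⟨c, hc0, hc, hgap⟩ := hR.exists_gap hL₀ he hSe
  obtain ⟨Q, Qi, hQ, hQi, hQQ⟩ := exists_resolvent he hSe hc0 hc hgap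
  have hpos : 0 < ‖R L₀‖ := hc0.trans_lt hc
  have hev : ∀ᶠ L in 𝓝 L₀, ∃ x : E, (⟪e, x⟫_ℝ = 0 ∧
      adjoint (R L) (R L (e + x)) = ‖R L‖ ^ 2 • (e + x)) ∧
      Φ L = (‖e + x‖ ^ 2)⁻¹ • tmul (e + x) (R L (e + x)) := by
    obtain ⟨c', hc', hev⟩ := hR.eventually_gap hc hgap
    filter_upwards [hev] with L ⟨hL1, hL2⟩
    have hU := hR.mem_uniqueBest (hc0.trans hc'.le) hL1 hL2
    obtain ⟨a, ha, hSa, hT⟩ := (hR.isBestTensor_iff hU.1).1 (hΦ L hU)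
    have hea : ⟪e, a⟫_ℝ ≠ 0 := fun h0 => by
      have := hL2 a h0
      rw [hSa, ha, mul_one] at this
      exact this.not_gt hL1
    -- Normalizing by `⟪e, e + x⟫ = 1` instead of unit length removes the sign ambiguity of the
    -- leading vector; dividing by `‖e + x‖²` compensates in the tensor.
    refine ⟨(⟪e, a⟫_ℝ)⁻¹ • a - e, ⟨?_, ?_⟩, ?_⟩
    · rw [inner_sub_right, inner_smul_right, real_inner_self_eq_norm_sq, he,
        inv_mul_cancel₀ hea]
      norm_num
    · rw [add_sub_cancel, map_smul, map_smul, adjoint_comp_eq_of_norm_eq ha hSa, smul_comm]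
    · rw [add_sub_cancel, hT, norm_smul, ha, mul_one, map_smul, map_smul, map_smul,
        LinearMap.smul_apply, smul_smul, smul_smul, Real.norm_eq_abs, sq_abs]
      rw [show ((⟪e, a⟫_ℝ)⁻¹ ^ 2)⁻¹ * (⟪e, a⟫_ℝ)⁻¹ * (⟪e, a⟫_ℝ)⁻¹ = 1 by field_simp, one_smul]
  obtain ⟨x, hx⟩ := hev.choice
  obtain ⟨hx0, x', hx', hform⟩ := hasFDerivAt_eigenvector he hSe hQ hQi (hx.mono fun L h => h.1)
  have hex : HasFDerivAt (fun L => e + x L) x' L₀ := hx'.const_add e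
  have hne : ‖e + x L₀‖ ^ 2 ≠ 0 := by simp [hx0, he]
  have hn := (hasDerivAt_inv hne).comp_hasFDerivAt L₀ hex.norm_sq
  have hb := (tmulB E F G).hasFDerivAt_of_bilinear hex (R.hasFDerivAt.clm_apply hex)
  have hfin := (hn.smul hb).congr_of_eventuallyEq (hx.mono fun L h => h.2)
  have hQx (h : G) : Q (x' h) =
      dropLine e (adjoint (R L₀) (R h e) + adjoint (R h) (R L₀ e)) := by
    rw [hform, hQQ]
  -- Pairing with `e` reduces `Q` to multiplication by `‖R L₀‖²`, while the right side lies in the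
  -- range of `dropLine e`.
  have horth (h : G) : ⟪e, x' h⟫_ℝ = 0 := by
    have h1 := inner_dropLine he (adjoint (R L₀) (R h e) + adjoint (R h) (R L₀ e))
    rw [← hQx, hQ, inner_add_right, inner_sub_right, inner_smul_right, inner_smul_right,
      adjoint_inner_right, ← adjoint_inner_left (R L₀), adjoint_comp_eq_of_norm_eq he hSe,
      real_inner_smul_left, real_inner_self_eq_norm_sq, he] at h1
    have h2 : ‖R L₀‖ ^ 2 * ⟪e, x' h⟫_ℝ = 0 := by linarith
    exact (mul_eq_zero.1 h2).resolve_left (pow_pos hpos 2).ne'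
  refine ⟨_, hfin, fun h => ⟨x' h, horth h, ?_, ?_⟩⟩
  · rw [← hQx, hQ, horth, mul_zero, zero_smul, add_zero]
  -- The factor `‖e + x‖⁻²` contributes nothing to first order, since `x' h ⟂ e` and `x L₀ = 0`.
  · simp [ContinuousLinearMap.precompR, ContinuousLinearMap.precompL, hx0, he, horth]
    abel

end BestTensorDeriv

/-! ### Expansion of the derivatives in eigenbases -/

section BasisExpansion
open ContinuousLinearMap

variable {E F : Type*} [NormedAddCommGroup E] [InnerProductSpace ℝ E] [CompleteSpace E]
  [NormedAddCommGroup F] [InnerProductSpace ℝ F] [CompleteSpace F]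

/-- The omitted Fourier coefficient is zero, so the sum over the remaining indices still recovers
`x`. -/
theorem tsum_ne_eq_of_inner_eq_zero {ι : Type*} (b : HilbertBasis ι ℝ E) {i₁ : ι} {x : E}
    (hx : ⟪b i₁, x⟫_ℝ = 0) {a : ι → ℝ} (ha : ∀ i, i ≠ i₁ → a i = ⟪b i, x⟫_ℝ) :
    ∑' i : {i // i ≠ i₁}, a i • b i = x := by
  have h1 : HasSum (fun i => ⟪b i, x⟫_ℝ • b i) x := by
    simpa [b.repr_apply_apply] using b.hasSum_repr x
  have h2 := (hasSum_subtype_iff_of_support_subset (s := {i | i ≠ i₁}) (fun i hi h => hi (by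
    rw [show i = i₁ from h, hx, zero_smul]))).2 h1
  rw [← h2.tsum_eq]
  exact tsum_congr fun i => by rw [ha i i.2]; rfl

/-- The derivatives of the singular vectors in terms of orthonormal bases of eigenvectors. -/
theorem singular_vector_deriv_eq {ι κ : Type*} {A K : E →L[ℝ] F} {e : HilbertBasis ι ℝ E}
    {f : HilbertBasis κ ℝ F} {i₁ : ι} {k₁ : κ} {γ c : ℝ} {α : ι → ℝ} {β : κ → ℝ}
    (hs : IsSingularTriple A γ (e i₁) (f k₁)) (hc0 : 0 ≤ c) (hc : c < γ)
    (hgap : ∀ x, ⟪e i₁, x⟫_ℝ = 0 → ‖A x‖ ≤ c * ‖x‖)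
    (hα : ∀ i, adjoint A (A (e i)) = α i • e i) (hβ : ∀ k, A (adjoint A (f k)) = β k • f k)
    {u : E} (hu0 : ⟪e i₁, u⟫_ℝ = 0)
    (hu : γ ^ 2 • u - adjoint A (A u) =
      dropLine (e i₁) (adjoint A (K (e i₁)) + adjoint K (A (e i₁)))) :
    ∑' i : {i // i ≠ i₁}, (⟪adjoint A (K (e i₁)) + adjoint K (A (e i₁)), e i⟫_ℝ /
      (γ ^ 2 - α i)) • e i = u ∧
    K (e i₁) + A u = ⟪K (e i₁), f k₁⟫_ℝ • f k₁ + γ • ∑' k : {k // k ≠ k₁},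
      (⟪A (adjoint K (f k₁)) + K (adjoint A (f k₁)), f k⟫_ℝ / (γ ^ 2 - β k)) • f k := by
  have hγ : 0 < γ := hc0.trans_lt hc
  obtain ⟨-, he1, hf1, hAe, hAf⟩ := hs
  have hαne (i : ι) (hi : i ≠ i₁) : γ ^ 2 - α i ≠ 0 := by
    have h1 := hgap (e i) (e.orthonormal.2 hi.symm)
    have h2 : ‖A (e i)‖ ^ 2 = α i := by
      rw [← real_inner_self_eq_norm_sq, ← adjoint_inner_left, hα, real_inner_smul_left,
        real_inner_self_eq_norm_sq, e.orthonormal.1]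
      norm_num
    rw [e.orthonormal.1, mul_one] at h1
    have h3 : ‖A (e i)‖ ^ 2 < γ ^ 2 := pow_lt_pow_left₀ (h1.trans_lt hc) (norm_nonneg _) two_ne_zero
    rw [← h2]
    exact (sub_pos.2 h3).ne'
  have horth (k : κ) (hk : k ≠ k₁) : ⟪e i₁, adjoint A (f k)⟫_ℝ = 0 := by
    rw [adjoint_inner_right, hAe, real_inner_smul_left, f.orthonormal.2 hk.symm, mul_zero]
  -- If `β k = γ²`, then `A* f k` would be orthogonal to `e i₁`, have norm `γ`, and be mapped by `A`
  -- to a vector of norm `γ²`, contradicting the gap.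
  have hβne (k : κ) (hk : k ≠ k₁) : γ ^ 2 - β k ≠ 0 := by
    intro h0
    have h1 := hgap _ (horth k hk)
    have h2 : ‖adjoint A (f k)‖ ^ 2 = γ ^ 2 := by
      rw [← real_inner_self_eq_norm_sq, adjoint_inner_left, hβ, real_inner_smul_right,
        real_inner_self_eq_norm_sq, f.orthonormal.1, sub_eq_zero.1 h0]
      norm_num
    rw [sq_eq_sq₀ (norm_nonneg _) hγ.le] at h2
    rw [h2, hβ, norm_smul, f.orthonormal.1, ← sub_eq_zero.1 h0, mul_one,
      Real.norm_of_nonneg (sq_nonneg _)] at h1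
    nlinarith
  have hkey (y : E) (hy : ⟪e i₁, y⟫_ℝ = 0) : ⟪γ ^ 2 • u - adjoint A (A u), y⟫_ℝ =
      ⟪adjoint A (K (e i₁)) + adjoint K (A (e i₁)), y⟫_ℝ := by
    rw [hu, dropLine_apply, inner_sub_left, real_inner_smul_left, hy, mul_zero, sub_zero]
  refine ⟨tsum_ne_eq_of_inner_eq_zero e (a := fun i =>
      ⟪adjoint A (K (e i₁)) + adjoint K (A (e i₁)), e i⟫_ℝ / (γ ^ 2 - α i)) hu0
      fun i hi => ?_, ?_⟩
  · rw [div_eq_iff (hαne i hi), ← hkey _ (e.orthonormal.2 hi.symm), inner_sub_left,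
      real_inner_smul_left, adjoint_inner_left, ← adjoint_inner_right, hα, real_inner_smul_right,
      real_inner_comm]
    ring
  -- The vector `v` is read off from the derivative of `A e₁ = γ f₁`: `K e₁ + A u = ⟪K e₁, f₁⟫ f₁ +
  -- γ v`.
  · rw [tsum_ne_eq_of_inner_eq_zero f (a := fun k =>
      ⟪A (adjoint K (f k₁)) + K (adjoint A (f k₁)), f k⟫_ℝ / (γ ^ 2 - β k))
      (x := γ⁻¹ • (K (e i₁) + A u - ⟪K (e i₁), f k₁⟫_ℝ • f k₁)) ?_ fun k hk => ?_,
      smul_inv_smul₀ hγ.ne']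
    · abel
    · rw [real_inner_smul_right, inner_sub_right, inner_add_right, real_inner_smul_right,
        real_inner_self_eq_norm_sq, hf1, ← adjoint_inner_left A, hAf, real_inner_smul_left, hu0,
        real_inner_comm]
      ring
    -- Testing the equation for `u` against `A* f k` gives `(γ² - β k) ⟪A u, f k⟫ = β k ⟪K e₁, f k⟫
    -- + γ ⟪A K* f₁, f k⟫`, from which the coefficient of `v` follows.
    · have h1 := hkey _ (horth k hk)
      rw [inner_sub_left, inner_add_left, real_inner_smul_left, adjoint_inner_left,
        adjoint_inner_left, hβ, adjoint_inner_left, hAe, real_inner_smul_right,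
        real_inner_smul_right, real_inner_smul_left, ← adjoint_inner_left K, adjoint_inner_right,
        adjoint_inner_right A] at h1
      rw [div_eq_iff (hβne k hk), hAf, map_smul, inner_add_left, real_inner_smul_left,
        real_inner_smul_right, inner_sub_right, inner_add_right, real_inner_smul_right,
        f.orthonormal.2 hk, real_inner_comm (K (e i₁)), real_inner_comm (A u)]
      field_simp
      linarith

end BasisExpansion

/-! ### Optimal separable approximation of Hilbert-Schmidt operators -/

section OptimalSeparable

open HilbertTensor ContinuousLinearMap

variable {H₁ H₂ H : Type*} [NormedAddCommGroup H₁] [InnerProductSpace ℝ H₁] [CompleteSpace H₁]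
  [NormedAddCommGroup H₂] [InnerProductSpace ℝ H₂] [CompleteSpace H₂]
  [NormedAddCommGroup H] [InnerProductSpace ℝ H] [CompleteSpace H] [HilbertTensor H₁ H₂ H]

theorem TC.toHS_ne_zero {C : TC H H} (hC : C ≠ 0) : C.toHS ≠ 0 := fun h =>
  hC (TC.toCLM_injective ((congrArg HS.toCLM h : _)))

/-- The rank-one operator `⟪e, ·⟫ x` as a Hilbert-Schmidt operator. -/
noncomputable def HS.rankOne {E F : Type*} [NormedAddCommGroup E] [InnerProductSpace ℝ E]
    [CompleteSpace E] [NormedAddCommGroup F] [InnerProductSpace ℝ F] (x : F) (e : E) : HS E F :=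
  ⟨InnerProductSpace.rankOne ℝ x e, by
    change Summable fun i => ‖InnerProductSpace.rankOne ℝ x e (stdBasis E i)‖ ^ 2
    have h := (HS.hasSum_sq_inner (stdBasis E) e).summable.mul_right (‖x‖ ^ 2)
    refine h.congr fun i => ?_
    rw [InnerProductSpace.rankOne_apply, norm_smul, mul_pow, Real.norm_eq_abs, sq_abs,
      real_inner_comm]⟩

theorem HS.toCLM_rankOne {E F : Type*} [NormedAddCommGroup E] [InnerProductSpace ℝ E]
    [CompleteSpace E] [NormedAddCommGroup F] [InnerProductSpace ℝ F] (x : F) (e y : E) :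
    HS.toCLM (HS.rankOne x e) y = ⟪e, y⟫_ℝ • x := rfl

/-- Testing against tensors of rank-one operators isolates the numbers `⟪L (eᵢ ⊗ fⱼ), x ⊗ y⟫`, which
determine `L`. -/
theorem HS.eq_zero_of_inner_tensor_eq_zero {L : HS H H}
    (h : ∀ (A : HS H₁ H₁) (B : HS H₂ H₂), ⟪L, HS.tensor A B⟫_ℝ = 0) : L = 0 := by
  have key (i : basisIndex H₁) (j : basisIndex H₂) (x : H₁) (y : H₂) :
      ⟪HS.toCLM L (tmul (stdBasis H₁ i) (stdBasis H₂ j)), (tmul x y : H)⟫_ℝ = 0 := by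
    have h1 := hasSum_inner_HS (prodBasis (stdBasis H₁) (stdBasis H₂)) L
      (HS.tensor (HS.rankOne x (stdBasis H₁ i)) (HS.rankOne y (stdBasis H₂ j)) : HS H H)
    rw [h] at h1
    simp only [HS.toCLM_tensor, prodBasis_apply, opTensor_tmul, HS.toCLM_rankOne] at h1
    -- Each rank-one factor annihilates all basis vectors but one, so only the term `(i, j)`
    -- remains.
    have h2 := (hasSum_single (i, j) fun p hp => ?_).unique h1
    · simpa [(stdBasis H₁).orthonormal.1, (stdBasis H₂).orthonormal.1] using h2
    · by_cases hi : p.1 = i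
      · have hj : j ≠ p.2 := fun hj => hp (Prod.ext hi hj.symm)
        rw [(stdBasis H₂).orthonormal.2 hj, zero_smul, map_zero, inner_zero_right]
      · rw [(stdBasis H₁).orthonormal.2 (Ne.symm hi), zero_smul, map_zero, LinearMap.zero_apply,
          inner_zero_right]
  refine HS.toCLM_injective ?_
  rw [map_zero]
  refine HS.clm_ext_basis (prodBasis (stdBasis H₁) (stdBasis H₂)) fun p => ?_
  rw [prodBasis_apply, zero_apply]
  have h3 : innerSL ℝ (HS.toCLM L (tmul (stdBasis H₁ p.1) (stdBasis H₂ p.2) : H)) = 0 :=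
    clm_ext_tmul (H₁ := H₁) (H₂ := H₂) fun x y => by simpa using key p.1 p.2 x y
  exact inner_self_eq_zero.1 (congrArg (fun T : H →L[ℝ] ℝ => T _) h3 : ⟪_, _⟫_ℝ = 0)

/-- `S₂(H, H)` is the tensor product Hilbert space of `S₂(H₁, H₁)` and `S₂(H₂, H₂)`. -/
noncomputable instance : HilbertTensor (HS H₁ H₁) (HS H₂ H₂) (HS H H) where
  tmul := HS.tensor
  inner_tmul A B A' B' := HS.inner_tensor A A' B B'
  dense_tmul := by
    rw [Submodule.dense_iff_topologicalClosure_eq_top, Submodule.topologicalClosure_eq_top_iff,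
      Submodule.eq_bot_iff]
    intro L hL
    refine HS.eq_zero_of_inner_tensor_eq_zero (H₁ := H₁) (H₂ := H₂) fun A B => ?_
    rw [real_inner_comm]
    exact (Submodule.mem_orthogonal _ _).1 hL _ (Submodule.subset_span ⟨(A, B), rfl⟩)

theorem isTensorToOp_restackL : IsTensorToOp (HS H₁ H₁) (HS H₂ H₂) (restackL H₁ H₂ H) :=
  fun L A B => inner_restack L A B

variable (H₁ H₂ H) in
/-- The nonzero operators with a unique optimal separable approximation. -/
def uniqueOptimal : Set (HS H H) := uniqueBest (HS H₁ H₁) (HS H₂ H₂) (restackL H₁ H₂ H)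

/-- `IsOptimalSeparable` is `IsBestTensor` for the tensor structure on Hilbert-Schmidt operators by
definition, and `Π` is injective. -/
theorem mem_uniqueOptimal {L : HS H H} (h0 : L ≠ 0)
    (h : ∃! T, IsOptimalSeparable H₁ H₂ L T) : L ∈ uniqueOptimal H₁ H₂ H :=
  ⟨fun hL => h0 (isTensorToOp_restackL.eq_zero hL), h⟩

theorem isOpen_uniqueOptimal : IsOpen (uniqueOptimal H₁ H₂ H) :=
  isTensorToOp_restackL.isOpen_uniqueBest

theorem smul_mem_uniqueOptimal {L : HS H H} (hL : L ∈ uniqueOptimal H₁ H₂ H) {c : ℝ}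
    (hc : c ≠ 0) : c • L ∈ uniqueOptimal H₁ H₂ H :=
  smul_mem_uniqueBest hL hc

/-- A top singular triple exists because `Π[L]` is compact and nonzero. Whichever one is chosen, `γ`
is the norm, `e` attains it, and `γ e ⊗ f = e ⊗ Π[L]e`. -/
theorem isOptimalSeparable_optApprox {L : HS H H} (h0 : restackL H₁ H₂ H L ≠ 0) :
    IsOptimalSeparable H₁ H₂ L (optApprox H₁ H₂ L) := by
  have hcpt := isTensorToOp_restackL.isCompactOperator (E := HS H₁ H₁) (F := HS H₂ H₂) L
  have hex : ∃ p : ℝ × HS H₁ H₁ × HS H₂ H₂,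
      IsTopSingularTriple (restack H₁ H₂ L) p.1 p.2.1 p.2.2 := by
    obtain ⟨e, f, h⟩ := exists_isTopSingularTriple hcpt h0
    exact ⟨(_, e, f), h⟩
  rw [optApprox, dif_pos hex]
  have h := hex.choose_spec
  have hγ : hex.choose.1 = ‖restackL H₁ H₂ H L‖ := h.eq_norm hcpt h0
  have h1 := isTensorToOp_restackL.isBestTensor_of_norm_eq h.1.2.1 (h.1.norm_apply.trans hγ)
  rw [restackL_apply, h.1.2.2.2.1, map_smul] at h1
  exact h1

/-- The singular vectors are chosen separately for `L` and `c L`, so homogeneity comes from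
uniqueness of the optimum, not from the definition. -/
theorem optApprox_smul {L : HS H H} (hL : L ∈ uniqueOptimal H₁ H₂ H) {c : ℝ} (hc : c ≠ 0) :
    optApprox H₁ H₂ (c • L) = c • optApprox H₁ H₂ L := by
  have h := smul_mem_uniqueOptimal hL hc
  exact h.2.unique (isOptimalSeparable_optApprox h.1)
    (isBestTensor_smul (isOptimalSeparable_optApprox hL.1) hc)

/-- The derivative of the optimal separable approximation, for given singular vectors. -/
theorem exists_hasFDerivAt_optApprox {C : HS H H} (hC : C ∈ uniqueOptimal H₁ H₂ H)
    {e₁ : HS H₁ H₁} {f₁ : HS H₂ H₂} {γ : ℝ}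
    (htop : IsTopSingularTriple (restack H₁ H₂ C) γ e₁ f₁) :
    ∃ Φ' : HS H H →L[ℝ] HS H H, HasFDerivAt (optApprox H₁ H₂) Φ' C ∧
      ∀ {ι κ : Type} (e : HilbertBasis ι ℝ (HS H₁ H₁)) (f : HilbertBasis κ ℝ (HS H₂ H₂))
        (i₁ : ι) (k₁ : κ) (α : ι → ℝ) (β : κ → ℝ), e i₁ = e₁ → f k₁ = f₁ →
        (∀ i, adjoint (restack H₁ H₂ C) (restack H₁ H₂ C (e i)) = α i • e i) →
        (∀ k, restack H₁ H₂ C (adjoint (restack H₁ H₂ C) (f k)) = β k • f k) →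
        ∀ h, h - Φ' h = optDeriv C γ e f i₁ k₁ α β h := by
  have hγ : γ = ‖restackL H₁ H₂ H C‖ :=
    htop.eq_norm (isTensorToOp_restackL.isCompactOperator (E := HS H₁ H₁) (F := HS H₂ H₂) C) hC.1
  have he := htop.1.2.1
  have hSe : ‖restackL H₁ H₂ H C e₁‖ = ‖restackL H₁ H₂ H C‖ := htop.1.norm_apply.trans hγ
  obtain ⟨c, hc0, hc, hgap⟩ := isTensorToOp_restackL.exists_gap hC he hSe
  obtain ⟨Φ', hΦ', hform⟩ := isTensorToOp_restackL.exists_hasFDerivAt hC he hSe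
    (Φ := optApprox H₁ H₂) fun L hL => isOptimalSeparable_optApprox hL.1
  refine ⟨Φ', hΦ', ?_⟩
  rintro ι κ e f i₁ k₁ α β rfl rfl hα hβ h
  obtain ⟨u, hu0, hu, hval⟩ := hform h
  rw [← hγ] at hc hu
  obtain ⟨h1, h2⟩ := singular_vector_deriv_eq (K := restackL H₁ H₂ H h) htop.1 hc0 hc hgap hα hβ
    hu0 hu
  rw [hval, optDeriv]
  simp only [restackL_apply] at h1 h2 ⊢
  rw [h1, h2, htop.1.2.2.2.1]
  change h - (HS.tensor u (γ • f k₁) + HS.tensor (e i₁) _) = _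
  rw [map_add, map_smul, map_smul, map_smul, smul_add]
  abel

/-- Differentiability holds at every point of the set, where a top singular triple always exists. -/
theorem continuousOn_optApprox :
    ContinuousOn (optApprox H₁ H₂ : HS H H → HS H H) (uniqueOptimal H₁ H₂ H) := by
  intro L hL
  obtain ⟨e, f, h⟩ := exists_isTopSingularTriple
    (isTensorToOp_restackL.isCompactOperator (E := HS H₁ H₁) (F := HS H₂ H₂) L) hL.1
  obtain ⟨Φ', hΦ', -⟩ := exists_hasFDerivAt_optApprox hL h
  exact hΦ'.continuousAt.continuousWithinAt

end OptimalSeparable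
end SepApprox

/-! ### The three residual maps along the ray -/

theorem theorem3p2
    (μ₁ μ₂ : Measure (Set.Icc (0 : ℝ) 1)) [IsFiniteMeasure μ₁] [IsFiniteMeasure μ₂]
    (a b : ℝ) (ha : 0 < a) (hab : a ≤ b) (hb : b ≤ 1)
    (C : TC (L2 (μ₁.prod μ₂)) (L2 (μ₁.prod μ₂))) :
    -- partial traces
    (TC.trace C ≠ 0 →
      (∀ᶠ L in 𝓝 (ray a b C), (∀ t, TC.trace (L t) ≠ 0) ∧
        Continuous fun t => trApprox (L2 μ₁) (L2 μ₂) (L t)) ∧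
      ∃ D : C(Set.Icc a b, TC (L2 (μ₁.prod μ₂)) (L2 (μ₁.prod μ₂))) →L[ℝ]
          C(Set.Icc a b, TC (L2 (μ₁.prod μ₂)) (L2 (μ₁.prod μ₂))),
        HasFDerivAt (seqResidual (trApprox (L2 μ₁) (L2 μ₂))) D (ray a b C) ∧
        ∀ h t, D h t = trDeriv (L2 μ₁) (L2 μ₂) C (h t)) ∧
    -- partial products
    (∀ Δ : HS (L2 μ₂) (L2 μ₂), (partialProd₂ C.toHS Δ : HS (L2 μ₁) (L2 μ₁)) ≠ 0 →
      (∀ᶠ L in 𝓝 (ray a b C.toHS),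
        (∀ t, (partialProd₂ (L t) Δ : HS (L2 μ₁) (L2 μ₁)) ≠ 0) ∧
        Continuous fun t => prodApprox (L2 μ₁) Δ (L t)) ∧
      ∃ D : C(Set.Icc a b, HS (L2 (μ₁.prod μ₂)) (L2 (μ₁.prod μ₂))) →L[ℝ]
          C(Set.Icc a b, HS (L2 (μ₁.prod μ₂)) (L2 (μ₁.prod μ₂))),
        HasFDerivAt (seqResidual (prodApprox (L2 μ₁) Δ)) D (ray a b C.toHS) ∧
        ∀ h t, D h t = prodDeriv (L2 μ₁) Δ C.toHS (h t)) ∧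
    -- optimal approximations
    (C ≠ 0 → (∃! T, IsOptimalSeparable (L2 μ₁) (L2 μ₂) C.toHS T) →
      (∀ᶠ L in 𝓝 (ray a b C.toHS),
        (∀ t, IsOptimalSeparable (L2 μ₁) (L2 μ₂) (L t) (optApprox (L2 μ₁) (L2 μ₂) (L t)) ∧
          ∀ T, IsOptimalSeparable (L2 μ₁) (L2 μ₂) (L t) T →
            T = optApprox (L2 μ₁) (L2 μ₂) (L t)) ∧
        Continuous fun t => optApprox (L2 μ₁) (L2 μ₂) (L t)) ∧
      ∃ D : C(Set.Icc a b, HS (L2 (μ₁.prod μ₂)) (L2 (μ₁.prod μ₂))) →L[ℝ]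
          C(Set.Icc a b, HS (L2 (μ₁.prod μ₂)) (L2 (μ₁.prod μ₂))),
        HasFDerivAt (seqResidual (optApprox (L2 μ₁) (L2 μ₂))) D (ray a b C.toHS) ∧
        ∀ (ι κ : Type) (e : HilbertBasis ι ℝ (HS (L2 μ₁) (L2 μ₁)))
          (f : HilbertBasis κ ℝ (HS (L2 μ₂) (L2 μ₂))) (i₁ : ι) (k₁ : κ) (γ : ℝ)
          (α : ι → ℝ) (β : κ → ℝ),
          IsTopSingularTriple (restack (L2 μ₁) (L2 μ₂) C.toHS) γ (e i₁) (f k₁) →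
          (∀ i, ContinuousLinearMap.adjoint (restack (L2 μ₁) (L2 μ₂) C.toHS)
            (restack (L2 μ₁) (L2 μ₂) C.toHS (e i)) = α i • e i) →
          (∀ k, restack (L2 μ₁) (L2 μ₂) C.toHS
            (ContinuousLinearMap.adjoint (restack (L2 μ₁) (L2 μ₂) C.toHS) (f k)) = β k • f k) →
          ∀ h t, D h t = optDeriv C.toHS γ e f i₁ k₁ α β (h t)) := by
  refine ⟨fun hC => ?_, fun Δ hΔ => ?_, fun hC huniq => ?_⟩
  · have hcone : ∀ x ∈ {L : TC (L2 (μ₁.prod μ₂)) (L2 (μ₁.prod μ₂)) | TC.trace L ≠ 0},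
        ∀ c : ℝ, 0 < c → c • x ∈ {L : TC (L2 (μ₁.prod μ₂)) (L2 (μ₁.prod μ₂)) | TC.trace L ≠ 0} :=
      fun x hx c hc => by
        have : TC.traceL (c • x) ≠ 0 := by simpa [hc.ne'] using hx
        exact this
    obtain ⟨Φ', hΦ', hform⟩ := exists_hasFDerivAt_trApprox (H₁ := L2 μ₁) (H₂ := L2 μ₂) hC
    refine ⟨?_, _, hasFDerivAt_seqResidual ha isOpen_trace_ne_zero hcone hC continuousOn_trApprox
      (fun x _ c hc => trApprox_smul x c hc.ne') hΦ', fun h t => hform (h t)⟩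
    filter_upwards [eventually_forall_mem_cone ha isOpen_trace_ne_zero hcone hC] with L hL
    exact ⟨hL, continuous_comp_of_forall_mem continuousOn_trApprox hL⟩
  · have hcone : ∀ x ∈ {L : HS (L2 (μ₁.prod μ₂)) (L2 (μ₁.prod μ₂)) |
          (partialProd₂ L Δ : HS (L2 μ₁) (L2 μ₁)) ≠ 0}, ∀ c : ℝ, 0 < c →
        c • x ∈ {L : HS (L2 (μ₁.prod μ₂)) (L2 (μ₁.prod μ₂)) |
          (partialProd₂ L Δ : HS (L2 μ₁) (L2 μ₁)) ≠ 0} :=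
      fun x hx c hc => by
        have : partialProdL₂ (H₁ := L2 μ₁) Δ (c • x) ≠ 0 := by
          rw [map_smul]
          exact smul_ne_zero hc.ne' hx
        exact this
    obtain ⟨Φ', hΦ', hform⟩ := exists_hasFDerivAt_prodApprox Δ hΔ
    refine ⟨?_, _, hasFDerivAt_seqResidual ha (isOpen_partialProd₂_ne_zero Δ) hcone hΔ
      (continuousOn_prodApprox Δ) (fun x _ c hc => prodApprox_smul Δ x c hc.ne') hΦ',
      fun h t => hform (h t)⟩
    filter_upwards [eventually_forall_mem_cone ha (isOpen_partialProd₂_ne_zero Δ) hcone hΔ]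
      with L hL
    exact ⟨hL, continuous_comp_of_forall_mem (continuousOn_prodApprox Δ) hL⟩
  · have hmem := mem_uniqueOptimal (TC.toHS_ne_zero hC) huniq
    have hcone := fun x (hx : x ∈ uniqueOptimal (L2 μ₁) (L2 μ₂) (L2 (μ₁.prod μ₂))) (c : ℝ)
      (hc : 0 < c) => smul_mem_uniqueOptimal hx hc.ne'
    obtain ⟨e₁, f₁, htop⟩ := exists_isTopSingularTriple
      (isTensorToOp_restackL.isCompactOperator (E := HS (L2 μ₁) (L2 μ₁))
        (F := HS (L2 μ₂) (L2 μ₂)) C.toHS) hmem.1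
    obtain ⟨Φ', hΦ', -⟩ := exists_hasFDerivAt_optApprox hmem htop
    refine ⟨?_, _, hasFDerivAt_seqResidual ha isOpen_uniqueOptimal hcone hmem
      continuousOn_optApprox (fun x hx c hc => optApprox_smul hx hc.ne') hΦ', ?_⟩
    · filter_upwards [eventually_forall_mem_cone ha isOpen_uniqueOptimal hcone hmem] with L hL
      refine ⟨fun t => ?_, continuous_comp_of_forall_mem continuousOn_optApprox hL⟩
      have hopt := isOptimalSeparable_optApprox (hL t).1
      exact ⟨hopt, fun T hT => (hL t).2.unique hT hopt⟩
    · intro ι κ e f i₁ k₁ γ α β htop' hα hβ h t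
      -- The derivative was built from one arbitrary choice of singular vectors; uniqueness of
      -- Fréchet derivatives transfers the formula to every other choice.
      obtain ⟨Ψ', hΨ', hform⟩ := exists_hasFDerivAt_optApprox hmem htop'
      rw [← hform e f i₁ k₁ α β rfl rfl hα hβ (h t), hΨ'.unique hΦ']
      rfl
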